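/- **Setting.** Let $M=(\mathcal S,\mathcal A,\mathbb P,r,H)$ be an episodic MDP with $H\ge 1$ steps, a measurable state space $\mathcal S$, a finite action space $\mathcal A$, initial state $s_1$, transition kernels $\mathbb P_h(\cdot\mid s,a)$ and known measurable rewards $r_h(s,a)\in[0,1]$ such that $\sum_h r_h(s_h,a_h)\le 1$ on all possible trajectories. For a policy $\pi$ let $V_1^\pi(s_1)$ be its expected cumulative reward. Let $\mathcal M$ be a finite class of models (sequences $f=(f_h)_{h\in[H]}$ of transition kernels) that contains the true model $\mathbb P$. For $f\in\mathcal M$ let $Q_{h,f}$, $V_{h,f}$ be the optimal value functions of the MDP with transitions $f$ and rewards $r$ (with $V_{H+1,f}=0$), and let $\pi_f$ be a measurable greedy policy, $\pi_{h,f}(s)\in\arg\max_a Q_{h,f}(s,a)$. Let $\mathcal V=\{\mathcal V_h\}_{h\in[H]}$ be finite nonempty classes of measurable functions $v:\mathcal S\times\mathcal A\times\mathcal S\to[-B,B]$ that are symmetric ($v\in\mathcal V_h\Rightarrow -v\in\mathcal V_h$) and complete (if $v_{s,a}\in\mathcal V_h$ for all $(s,a)$, then $(s,a,s')\mapsto v_{s,a}(s,a,s')$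 is in $\mathcal V_h$); put $|\mathcal V|=\max_h|\mathcal V_h|$. **Witness rank.** For $\kappa\in(0,1]$, the witness rank $W_\kappa$ is the smallest $d$ for which there are mappings $W_h,X_h:\mathcal M\to\mathbb R^d$ such that for all $h\in[H]$ and $f,g\in\mathcal M$ $$\max_{v\in\mathcal V_h}\mathbb E_{s_h\sim\pi_f,\,a_h\sim\pi_g}\big[\mathbb E_{\tilde s\sim g_h}v(s_h,a_h,\tilde s)-\mathbb E_{\tilde s\sim\mathbb P_h}v(s_h,a_h,\tilde s)\big]\ \ge\ |\langle W_h(g),X_h(f)\rangle|,$$ $$\kappa\cdot\mathbb E_{s_h\sim\pi_f,\,a_h\sim\pi_g}\big[\mathbb E_{\tilde s\sim g_h}V_{h+1,g}(\tilde s)-\mathbb E_{\tilde s\sim\mathbb P_h}V_{h+1,g}(\tilde s)\big]\ \le\ \langle W_h(g),X_h(f)\rangle .$$ **Algorithm (V-type OPERA with parameter $\beta$, $T$ iterations).** In iteration $t=1,\dots,T$, choose $f^t$ (measurably in the data, ties broken arbitrarily) as a maximizer of $Q_{1,f}(s_1,\pi_{1,f}(s_1))$ over all $f\in\mathcal M$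 that satisfy, for all $h\in[H]$, $$\max_{v\in\mathcal V_h}\Big\{\sum_{i<t}\big(\mathbb E_{\tilde s\sim f_h}v(s_h^i,a_h^i,\tilde s)-v(s_h^i,a_h^i,s_{h+1}^i)\big)^2-\inf_{g\in\mathcal M}\sum_{i<t}\big(\mathbb E_{\tilde s\sim g_h}v(s_h^i,a_h^i,\tilde s)-v(s_h^i,a_h^i,s_{h+1}^i)\big)^2\Big\}\le\beta$$ (arbitrary if there is no such $f$); set $\pi^t=\pi_{f^t}$; then, independently for each $h\in[H]$, roll in $s_h^t\sim\pi^t$, draw $a_h^t$ uniformly from $\mathcal A$, and observe $s_{h+1}^t\sim\mathbb P_h(\cdot\mid s_h^t,a_h^t)$. The output $\pi_{\mathrm{out}}$ is the policy that is drawn uniformly from $\{\pi^t\}_{t\le T}$, so that $V_1^{\pi_{\mathrm{out}}}(s_1)=\frac1T\sum_{t=1}^T V_1^{\pi^t}(s_1)$. **Theorem (finite witness rank).** For every $B>0$ there are constants $c,C>0$, depending only on $B$, such that for every setting as above in which the witness rank $W_\kappa$ is finite, and for all $\varepsilon>0$ and $\delta\in(0,1)$, the following holds with $K(\beta)=H^2|\mathcal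 A|W_\kappa\,\beta/(\kappa^2\varepsilon^2)$. 1. If $T\ge1$, $\beta\ge c\log(TH|\mathcal M||\mathcal V|/\delta)$ and $T\ge C\,K(\beta)\log(2+K(\beta))$, then with probability at least $1-\delta$ over the data, OPERA with parameter $\beta$ and $T$ iterations outputs an $\varepsilon$-optimal policy: $V_1^\pi(s_1)-V_1^{\pi_{\mathrm{out}}}(s_1)\le\varepsilon$ for every policy $\pi$. 2. For every $b\ge c$ there is $T\ge1$ which satisfies $C\,K(\beta)\log(2+K(\beta))\le T\le 1+C\,K(\beta)\log(2+K(\beta))$ with $\beta=b\log(TH|\mathcal M||\mathcal V|/\delta)$. Thus, with $\beta=O(\log(TH|\mathcal M||\mathcal V|/\delta))$, $T=\tilde O\big(H^2|\mathcal A|W_\kappa\beta/(\kappa^2\varepsilon^2)\big)$ iterations suffice. -/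

import Mathlib

open MeasureTheory ProbabilityTheory

universe u v w

namespace Opera

noncomputable section

variable {S : Type u} {A : Type v} {ι : Type w} {H : ℕ} [MeasurableSpace S] [MeasurableSpace A]

/-! The steps `h = 1, …, H` of an episode are the elements `0, …, H - 1` of `Fin H`. -/

/-- The transition kernels `ℙ₁, …, ℙ_H` of an `H`-step model. -/
abbrev Transition (S : Type u) (A : Type v) (H : ℕ) [MeasurableSpace S] [MeasurableSpace A] :=
  Fin H → Kernel (S × A) S

/-- A reward function `r_h(s, a)`. -/
abbrev Reward (S : Type u) (A : Type v) (H : ℕ) := Fin H → S → A → ℝ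

/-- A deterministic policy `(π_h : S → A)_h`. -/
abbrev Policy (S : Type u) (A : Type v) (H : ℕ) := Fin H → S → A

/-- The policies that can be executed: those with measurable components. -/
def IsPolicy (π : Policy S A H) : Prop := ∀ h, Measurable (π h)

/-- The law of the states `(s₁, …, s_{n+1})` when the policy `π` is run from the state `s₁` in the
model with transitions `P`. -/
def pathLaw (P : Transition S A H) (π : Policy S A H) (s₁ : S) :
    (n : ℕ) → n ≤ H → Measure (Fin (n + 1) → S)
  | 0, _ => Measure.dirac fun _ => s₁
  | n + 1, hn =>
    (pathLaw P π s₁ n (Nat.le_of_succ_le hn)).bind fun p =>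
      (P ⟨n, hn⟩ (p (Fin.last n), π ⟨n, hn⟩ (p (Fin.last n)))).map
        fun s' => (Fin.snoc p s' : Fin (n + 1 + 1) → S)

/-- The law of the state `s_h` under `π`. -/
def stateLaw (P : Transition S A H) (π : Policy S A H) (s₁ : S) (h : Fin H) : Measure S :=
  (pathLaw P π s₁ h h.2.le).map fun p => p (Fin.last h)

/-- The cumulative reward along a path of states whose actions are chosen by `π`. -/
def totalReward (r : Reward S A H) (π : Policy S A H) (p : Fin (H + 1) → S) : ℝ :=
  ∑ h : Fin H, r h (p h.castSucc) (π h (p h.castSucc))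

/-- The value `V₁^π(s₁)`: the expected cumulative reward of `π` from `s₁`. -/
def value (P : Transition S A H) (r : Reward S A H) (s₁ : S) (π : Policy S A H) : ℝ :=
  ∫ p, totalReward r π p ∂(pathLaw P π s₁ H le_rfl)

/-- Standing assumption on the reward: measurable, nonnegative, with values in `[0, 1]`, and with
cumulative reward at most `1` on all possible trajectories. -/
structure IsReward (P : Transition S A H) (r : Reward S A H) (s₁ : S) : Prop where
  measurable : ∀ h, Measurable fun x : S × A => r h x.1 x.2
  nonneg : ∀ h s a, 0 ≤ r h s a
  le_one : ∀ h s a, r h s a ≤ 1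
  total_le_one : ∀ π : Policy S A H, IsPolicy π →
    ∀ᵐ p ∂(pathLaw P π s₁ H le_rfl), totalReward r π p ≤ 1

/-- The optimal state value function `V*_h` of the model `(P, r)`, by dynamic programming. The
index `h` runs through `0, …, H`, and the value at `H` is `0`. -/
def vOpt (P : Transition S A H) (r : Reward S A H) (h : ℕ) (s : S) : ℝ :=
  if hh : h < H then
    ⨆ a : A, (r ⟨h, hh⟩ s a + ∫ s', vOpt P r (h + 1) s' ∂(P ⟨h, hh⟩ (s, a)))
  else 0
termination_by H - h

/-- The optimal action value function `Q*_h` of the model `(P, r)`. -/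
def qOpt (P : Transition S A H) (r : Reward S A H) (h : Fin H) (s : S) (a : A) : ℝ :=
  r h s a + ∫ s', vOpt P r (h + 1) s' ∂(P h (s, a))

/-- `π` is a greedy policy for the optimal action values of the model `(P, r)`. -/
def IsGreedy (P : Transition S A H) (r : Reward S A H) (π : Policy S A H) : Prop :=
  ∀ h s a, qOpt P r h s a ≤ qOpt P r h s (π h s)

/-- Finite discriminator classes `𝒱_h`: nonempty classes of measurable functions bounded by `B`,
symmetric and complete. -/
structure IsDiscriminatorClass (V : Fin H → Finset (S → A → S → ℝ)) (B : ℝ) : Prop where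
  nonempty : ∀ h, (V h).Nonempty
  measurable : ∀ h, ∀ v ∈ V h, Measurable fun x : (S × A) × S => v x.1.1 x.1.2 x.2
  bounded : ∀ h, ∀ v ∈ V h, ∀ s a s', |v s a s'| ≤ B
  symmetric : ∀ h, ∀ v ∈ V h, -v ∈ V h
  complete : ∀ h, ∀ w : S → A → S → A → S → ℝ, (∀ s a, w s a ∈ V h) →
    (fun s a s' => w s a s a s') ∈ V h

/-- The cardinality `|𝒱|`, the largest cardinality of the classes `𝒱_h`. -/
def discCard (V : Fin H → Finset (S → A → S → ℝ)) : ℕ :=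
  Finset.univ.sup fun h => (V h).card

/-- `𝔼_{s_h ∼ π_f, a_h ∼ π_g} [𝔼_{s̃ ∼ g_h} φ(s_h, a_h, s̃) - 𝔼_{s̃ ∼ ℙ_h} φ(s_h, a_h, s̃)]`, where `P`
is the true model, `Pg` the model of `g`, and `πf`, `πg` are the policies of `f` and `g`. -/
def modelGap (P Pg : Transition S A H) (s₁ : S) (πf πg : Policy S A H) (h : Fin H)
    (φ : S → A → S → ℝ) : ℝ :=
  ∫ s, ((∫ s', φ s (πg h s) s' ∂(Pg h (s, πg h s))) -
    ∫ s', φ s (πg h s) s' ∂(P h (s, πg h s))) ∂(stateLaw P πf s₁ h)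

/-- The model class `M` admits witness embeddings of dimension `d` with parameter `κ`. As `𝒱_h` is
finite, a bound by the maximum over `v ∈ 𝒱_h` is a bound by the term of some `v`. -/
def HasWitnessEmbedding (P : Transition S A H) (r : Reward S A H) (s₁ : S)
    (M : ι → Transition S A H) (π : ι → Policy S A H) (V : Fin H → Finset (S → A → S → ℝ))
    (κ : ℝ) (d : ℕ) : Prop :=
  ∃ W X : Fin H → ι → EuclideanSpace ℝ (Fin d), ∀ h f g,
    (∃ v ∈ V h, |inner ℝ (W h g) (X h f)| ≤ modelGap P (M g) s₁ (π f) (π g) h v) ∧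
    κ * modelGap P (M g) s₁ (π f) (π g) h (fun _ _ s' => vOpt (M g) r (h + 1) s')
      ≤ inner ℝ (W h g) (X h f)

/-- The witness rank `W_κ`: the smallest dimension of witness embeddings (meaningful if there are
such embeddings of some finite dimension). -/
def witnessRank (P : Transition S A H) (r : Reward S A H) (s₁ : S)
    (M : ι → Transition S A H) (π : ι → Policy S A H) (V : Fin H → Finset (S → A → S → ℝ))
    (κ : ℝ) : ℕ :=
  sInf {d | HasWitnessEmbedding P r s₁ M π V κ d}

/-- The data collected in one iteration: for every step `h` a tuple `((s_h, a_h), s_{h+1})`. (The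
reward is the known function `r_h(s_h, a_h)` of the tuple.) -/
abbrev Batch (S : Type u) (A : Type v) (H : ℕ) := Fin H → (S × A) × S

/-- The loss `∑ᵢ (𝔼_{s̃ ∼ f_h} v(s_hⁱ, a_hⁱ, s̃) - v(s_hⁱ, a_hⁱ, s_{h+1}ⁱ))²` of the model `Pf` on the data
of `t` iterations. -/
def witnessLoss {t : ℕ} (Pf : Transition S A H) (D : Fin t → Batch S A H) (h : Fin H)
    (v : S → A → S → ℝ) : ℝ :=
  ∑ i, ((∫ s', v (D i h).1.1 (D i h).1.2 s' ∂(Pf h (D i h).1))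
    - v (D i h).1.1 (D i h).1.2 (D i h).2) ^ 2

/-- The confidence region of OPERA. -/
def confSet {t : ℕ} (M : ι → Transition S A H) (V : Fin H → Finset (S → A → S → ℝ)) (β : ℝ)
    (D : Fin t → Batch S A H) : Set ι :=
  {f | ∀ h, ∀ v ∈ V h, witnessLoss (M f) D h v - ⨅ g, witnessLoss (M g) D h v ≤ β}

/-- `sel` is a rule by which OPERA chooses `f^{t+1}` from the data of the first `t` iterations: a
(measurable) maximizer of `Q_{f,1}(s₁, π_f(s₁))` over the confidence region, with an arbitrary
choice if the region is empty. -/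
structure IsOperaRule [NeZero H] (r : Reward S A H) (s₁ : S) (M : ι → Transition S A H)
    (π : ι → Policy S A H) (V : Fin H → Finset (S → A → S → ℝ)) (β : ℝ)
    (sel : (t : ℕ) → (Fin t → Batch S A H) → ι) : Prop where
  measurable : ∀ t f, MeasurableSet (sel t ⁻¹' {f})
  feasible : ∀ t D, (confSet M V β D).Nonempty → sel t D ∈ confSet M V β D
  maximal : ∀ t D, ∀ f ∈ confSet M V β D,
    qOpt (M f) r 0 s₁ (π f 0 s₁) ≤ qOpt (M (sel t D)) r 0 s₁ (π (sel t D) 0 s₁)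

/-- The law of `((s_h, a_h), s_{h+1})` when `s_h` is reached by running `π`, `a_h` is uniformly
distributed on `A`, and `s_{h+1} ∼ ℙ_h(· | s_h, a_h)`. -/
def tupleLaw [Fintype A] [Nonempty A] (P : Transition S A H) (s₁ : S) (π : Policy S A H)
    (h : Fin H) : Measure ((S × A) × S) :=
  ((stateLaw P π s₁ h).prod (PMF.uniformOfFintype A).toMeasure) ⊗ₘ P h

/-- The law of the data of the first `T` iterations of OPERA in the MDP with transitions `P`. In
each iteration the tuples of the `H` steps come from independent roll-outs. -/
def operaLaw [Fintype A] [Nonempty A] (P : Transition S A H) (s₁ : S) (π : ι → Policy S A H)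
    (sel : (t : ℕ) → (Fin t → Batch S A H) → ι) : (T : ℕ) → Measure (Fin T → Batch S A H)
  | 0 => Measure.dirac Fin.elim0
  | t + 1 => (operaLaw P s₁ π sel t).bind fun D =>
      (Measure.pi fun h => tupleLaw P s₁ (π (sel t D)) h).map
        fun b => (Fin.snoc D b : Fin (t + 1) → Batch S A H)

/-- The value of the output `π_out` of `T` iterations, the policy that draws `t` uniformly from the
`T` iterations and then runs `π^t = π_{f^t}`, as a function of the data. -/
def outputValue (P : Transition S A H) (r : Reward S A H) (s₁ : S) (π : ι → Policy S A H)
    (sel : (t : ℕ) → (Fin t → Batch S A H) → ι) {T : ℕ} (D : Fin T → Batch S A H) : ℝ :=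
  (∑ t : Fin T, value P r s₁ (π (sel t fun i : Fin t => D (i.castLE t.2.le)))) / T

/-- A (randomized) policy with value `x` is `ε`-optimal. -/
def IsEpsOptimal (P : Transition S A H) (r : Reward S A H) (s₁ : S) (ε x : ℝ) : Prop :=
  ∀ π : Policy S A H, IsPolicy π → value P r s₁ π - x ≤ ε

/-- The quantity `log (T H |ℳ| |𝒱| / δ)`. -/
def logTerm (T H m n : ℕ) (δ : ℝ) : ℝ := Real.log (T * H * m * n / δ)

/-- The quantity `H² |A| W β / (κ² ε²)`. -/
def complexity (H a W : ℕ) (β κ ε : ℝ) : ℝ := (H : ℝ) ^ 2 * a * W * β / (κ ^ 2 * ε ^ 2)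

end

end Opera

namespace Opera

/-! ### Barycentric spanners and the elliptic potential -/

section LinearAlgebra

/-! The argument is optimism combined with an elliptic potential. If the true model is in every
confidence region, the chosen `f^t` satisfies `V_{1,f^t}(s₁) ≥ V*_1(s₁)`, so the regret of iteration
`t` is at most `V_{1,f^t}(s₁)` minus the true value of `π^t`. By `vOpt_sub_value_eq` this difference
telescopes into the Bellman errors of `f^t` along its own roll-in, and the second witness inequality
bounds each of these by `⟨W_h(f^t), X_h(f^t)⟩ / κ`.

The diagonal terms are controlled by the off-diagonal ones with `i < t`. The first witness
inequality bounds `|⟨W_h(f^t), X_h(f^i)⟩|` by a model gap of some discriminator that may depend on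
`i`. Completeness and symmetry replace it by one discriminator for all `i`, and
`sq_modelGap_le_card_mul_meanSqErr` passes to uniform actions at the cost of a factor `|A|`. By
`confSet_of_deviation_le`, membership of `f^t` in the confidence region keeps the sum of the past
squared errors below `8β`. `sum_inner_sq_le` then bounds the sum of the squared diagonal terms by
about `|A| β d log T`, and Cauchy–Schwarz over `t` gives the regret. The embeddings come without
norm bounds, so the potential argument runs in the coordinates of a barycentric spanner, where
boundedness of the bilinear form suffices.

The statistical input is `lintegral_exp_excess_loss_le`: the excess squared loss of a wrong model
over the true one dominates a multiple of its mean squared error, up to an exponential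
supermartingale. Markov's inequality and a union bound over iterations, steps, discriminators and
models give the good event. What remains is numerical: `iterations_bound` turns the condition on `T`
into average regret at most `ε`, and `exists_nat_mul_log_le` finds a `T` of the claimed size
although `β` itself depends on `T`. -/

theorem exists_barycentric_spanner_of_span_eq_top {ι E : Type*} [Finite ι] [AddCommGroup E]
    [Module ℝ E] [FiniteDimensional ℝ E] (X : ι → E)
    (hX : Submodule.span ℝ (Set.range X) = ⊤) :
    ∃ (φ : Fin (Module.finrank ℝ E) → ι) (c : ι → Fin (Module.finrank ℝ E) → ℝ),
      (∀ f j, |c f j| ≤ 1) ∧ ∀ f, X f = ∑ j, c f j • X (φ j) := by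
  classical
  obtain ⟨m, a, -, hsp, hli⟩ := exists_linearIndependent' ℝ X
  let b₀ : Module.Basis m ℝ E := Module.Basis.mk hli (by rw [hsp, hX])
  have : Finite m := Module.Finite.finite_basis b₀
  have : Fintype m := Fintype.ofFinite m
  let e : m ≃ Fin (Module.finrank ℝ E) :=
    Fintype.equivFinOfCardEq (Module.finrank_eq_card_basis b₀).symm
  let b : Module.Basis (Fin (Module.finrank ℝ E)) ℝ E := b₀.reindex e
  have hb : (b : Fin (Module.finrank ℝ E) → E) = X ∘ (a ∘ e.symm) := by
    ext j; simp [b, b₀]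
  have : Nonempty (Fin (Module.finrank ℝ E) → ι) := ⟨a ∘ e.symm⟩
  -- The spanner is a subfamily of maximal volume. Its volume is nonzero because the basis `b` is
  -- itself a subfamily.
  obtain ⟨φ, hφ⟩ := Finite.exists_max fun φ : Fin (Module.finrank ℝ E) → ι => |b.det (X ∘ φ)|
  have hpos : 0 < |b.det (X ∘ φ)| := by
    have h1 := hφ (a ∘ e.symm)
    rw [← hb, b.det_self, abs_one] at h1
    linarith
  have hunit : IsUnit (b.det (X ∘ φ)) := (abs_pos.1 hpos).isUnit
  obtain ⟨hli', hsp'⟩ := (Module.Basis.is_basis_iff_det b).2 hunit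
  let b' : Module.Basis (Fin (Module.finrank ℝ E)) ℝ E := Module.Basis.mk hli' hsp'.ge
  refine ⟨φ, fun f j => b'.coord j (X f), fun f j => ?_, fun f => ?_⟩
  -- Cramer's rule: a coordinate of `X f` is the ratio of the volume after exchanging one vector for
  -- `X f` to the maximal volume.
  · have h := congrArg (fun l => l (X f)) (b.det_smul_mk_coord_eq_det_update hli' hsp'.ge j)
    simp only [LinearMap.smul_apply, smul_eq_mul, MultilinearMap.toLinearMap_apply] at h
    have h2 : Function.update (X ∘ φ) j (X f) = X ∘ Function.update φ j f := by
      rw [Function.comp_update]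
    have h3 := hφ (Function.update φ j f)
    have h4 : b.det (X ∘ φ) * b'.coord j (X f) = b.det (X ∘ Function.update φ j f) := by
      rw [← h2]; exact h
    rw [← h4, abs_mul] at h3
    exact (mul_le_iff_le_one_right hpos).1 h3
  · conv_lhs => rw [← b'.sum_repr (X f)]
    simp [b']

/-- Every finite family of vectors has a subfamily, of length at most the dimension, in terms of
which all members are linear combinations with coefficients in `[-1, 1]`. -/
theorem exists_barycentric_spanner {ι E : Type*} [Finite ι] [AddCommGroup E]
    [Module ℝ E] [FiniteDimensional ℝ E] (X : ι → E) :
    ∃ r ≤ Module.finrank ℝ E, ∃ (φ : Fin r → ι) (c : ι → Fin r → ℝ),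
      (∀ f j, |c f j| ≤ 1) ∧ ∀ f, X f = ∑ j, c f j • X (φ j) := by
  let U := Submodule.span ℝ (Set.range X)
  let Y : ι → U := fun f => ⟨X f, Submodule.subset_span ⟨f, rfl⟩⟩
  have hY : Submodule.span ℝ (Set.range Y) = ⊤ := by
    apply Submodule.map_injective_of_injective U.injective_subtype
    rw [Submodule.map_span, ← Set.range_comp, Submodule.map_top, Submodule.range_subtype]
    rfl
  obtain ⟨φ, c, hc, h⟩ := exists_barycentric_spanner_of_span_eq_top Y hY
  refine ⟨_, Submodule.finrank_le U, φ, c, hc, fun f => ?_⟩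
  have := congrArg (Submodule.subtype U) (h f)
  simpa [Y] using this

open Matrix

variable {n : Type*} [Fintype n] [DecidableEq n]

/-- Cauchy–Schwarz for a norm and its dual: the quadratic form of `A` at `w + s • A⁻¹x` is a
nonnegative quadratic polynomial in `s`, so its discriminant is nonpositive. -/
theorem dotProduct_sq_le_of_posDef {A : Matrix n n ℝ} (hA : A.PosDef) (w x : n → ℝ) :
    (w ⬝ᵥ x) ^ 2 ≤ (w ⬝ᵥ A *ᵥ w) * (x ⬝ᵥ A⁻¹ *ᵥ x) := by
  have hdet : IsUnit A.det := hA.det_pos.ne'.isUnit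
  have hAT : Aᵀ = A := by simpa using hA.isHermitian.eq
  set y := A⁻¹ *ᵥ x with hy
  have hAy : A *ᵥ y = x := by rw [hy, mulVec_mulVec, mul_nonsing_inv _ hdet, one_mulVec]
  have hsymm : y ⬝ᵥ A *ᵥ w = w ⬝ᵥ x := by
    rw [dotProduct_mulVec, ← mulVec_transpose, hAT, hAy, dotProduct_comm]
  have h0 : ∀ s : ℝ, 0 ≤ (x ⬝ᵥ y) * (s * s) + (2 * (w ⬝ᵥ x)) * s + w ⬝ᵥ A *ᵥ w := by
    intro s
    have h := hA.posSemidef.dotProduct_mulVec_nonneg (w + s • y)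
    simp only [star_trivial, mulVec_add, mulVec_smul, hAy, dotProduct_add, add_dotProduct,
      smul_dotProduct, dotProduct_smul, smul_eq_mul, hsymm] at h
    rw [dotProduct_comm y x] at h
    linarith
  have := discrim_le_zero h0
  rw [discrim] at this
  nlinarith

/-- Each eigenvalue is at most the trace. This is weaker than the arithmetic–geometric mean
inequality, but it is only used inside a logarithm. -/
theorem det_le_trace_pow {A : Matrix n n ℝ} (hA : A.PosSemidef) :
    A.det ≤ A.trace ^ Fintype.card n := by
  rw [hA.isHermitian.det_eq_prod_eigenvalues, hA.isHermitian.trace_eq_sum_eigenvalues]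
  simp only [RCLike.ofReal_real_eq_id, id]
  calc ∏ i, hA.isHermitian.eigenvalues i
      ≤ ∏ _i : n, ∑ j, hA.isHermitian.eigenvalues j :=
        Finset.prod_le_prod (fun i _ => hA.eigenvalues_nonneg i) fun i _ =>
          Finset.single_le_sum (f := hA.isHermitian.eigenvalues)
            (fun j _ => hA.eigenvalues_nonneg j) (Finset.mem_univ i)
    _ = _ := by simp

/-- The regularized Gram matrix of the vectors `x 0, …, x (t - 1)`. -/
noncomputable def gram (l : ℝ) (x : ℕ → n → ℝ) (t : ℕ) : Matrix n n ℝ :=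
  l • 1 + ∑ i ∈ Finset.range t, vecMulVec (x i) (x i)

theorem posDef_gram {l : ℝ} (hl : 0 < l) (x : ℕ → n → ℝ) (t : ℕ) : (gram l x t).PosDef := by
  refine (Matrix.PosDef.one.smul hl).add_posSemidef (posSemidef_sum _ fun i _ => ?_)
  simpa using posSemidef_vecMulVec_self_star (x i)

theorem dotProduct_gram (l : ℝ) (x : ℕ → n → ℝ) (t : ℕ) (w : n → ℝ) :
    w ⬝ᵥ gram l x t *ᵥ w = l * (w ⬝ᵥ w) + ∑ i ∈ Finset.range t, (w ⬝ᵥ x i) ^ 2 := by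
  simp only [gram, add_mulVec, smul_mulVec, one_mulVec, dotProduct_add, dotProduct_smul,
    smul_eq_mul, sum_mulVec, dotProduct_sum, vecMulVec_mulVec]
  congr 1
  refine Finset.sum_congr rfl fun i _ => ?_
  simp [dotProduct_comm (x i) w, sq]

theorem trace_gram (l : ℝ) (x : ℕ → n → ℝ) (t : ℕ) :
    (gram l x t).trace = l * Fintype.card n + ∑ i ∈ Finset.range t, x i ⬝ᵥ x i := by
  simp [gram, trace_add, trace_sum, trace_vecMulVec]

/-- The matrix determinant lemma for a rank-one update. It makes the logarithms of the factors
telescope. -/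
theorem det_gram_succ {l : ℝ} (hl : 0 < l) (x : ℕ → n → ℝ) (t : ℕ) :
    (gram l x (t + 1)).det = (gram l x t).det * (1 + x t ⬝ᵥ (gram l x t)⁻¹ *ᵥ x t) := by
  have hdet : IsUnit (gram l x t).det := (posDef_gram hl x t).det_pos.ne'.isUnit
  have h := det_add_replicateCol_mul_replicateRow (ι := Unit) hdet (x t) (x t)
  have h2 : gram l x (t + 1) = gram l x t + replicateCol Unit (x t) * replicateRow Unit (x t) := by
    rw [gram, Finset.sum_range_succ, ← add_assoc, ← vecMulVec_eq Unit]
    rfl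
  rw [h2, h]
  simp [Matrix.mul_assoc, det_unique, Matrix.mul_apply, dotProduct, mulVec, replicateRow,
    replicateCol]

theorem sum_log_gram {l : ℝ} (hl : 0 < l) (x : ℕ → n → ℝ) (t : ℕ) :
    ∑ i ∈ Finset.range t, Real.log (1 + x i ⬝ᵥ (gram l x i)⁻¹ *ᵥ x i)
      = Real.log (gram l x t).det - Real.log (gram l x 0).det := by
  induction t with
  | zero => simp
  | succ t ih =>
    have h0 : 0 ≤ x t ⬝ᵥ (gram l x t)⁻¹ *ᵥ x t := by
      simpa using (posDef_gram hl x t).inv.posSemidef.dotProduct_mulVec_nonneg (x t)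
    rw [Finset.sum_range_succ, ih, det_gram_succ hl,
      Real.log_mul (posDef_gram hl x t).det_pos.ne' (by positivity)]
    ring

theorem min_one_le_two_mul_log {y : ℝ} (hy : 0 ≤ y) : min 1 y ≤ 2 * Real.log (1 + y) := by
  have key : ∀ z : ℝ, 0 ≤ z → z ≤ 1 → z ≤ 2 * Real.log (1 + z) := by
    intro z hz hz1
    have h := Real.one_sub_inv_le_log_of_pos (show (0 : ℝ) < 1 + z by positivity)
    have : z / 2 ≤ 1 - (1 + z)⁻¹ := by
      rw [show 1 - (1 + z)⁻¹ = z / (1 + z) by field_simp; ring]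
      exact div_le_div_of_nonneg_left hz (by positivity) (by linarith)
    linarith
  rcases le_total y 1 with h | h
  · rw [min_eq_right h]; exact key y hy h
  · rw [min_eq_left h]
    have h1 := key 1 zero_le_one le_rfl
    have h2 : Real.log (1 + 1) ≤ Real.log (1 + y) := Real.log_le_log (by norm_num) (by linarith)
    linarith

theorem dotProduct_self_le {n : Type*} [Fintype n] {x : n → ℝ} {b : ℝ} (hx : ∀ j, |x j| ≤ b) :
    x ⬝ᵥ x ≤ Fintype.card n * b ^ 2 := by
  calc x ⬝ᵥ x ≤ ∑ _j : n, b ^ 2 := Finset.sum_le_sum fun j _ => by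
        rw [← sq, ← sq_abs]; exact pow_le_pow_left₀ (abs_nonneg _) (hx j) 2
    _ = _ := by simp

/-- The elliptic potential lemma for bilinear forms. -/
theorem sum_dotProduct_sq_le {x w : ℕ → n → ℝ} {b R : ℝ} {T d : ℕ} (hd : 1 ≤ d)
    (hn : Fintype.card n ≤ d) (hx : ∀ t j, |x t j| ≤ 1) (hw : ∀ t j, |w t j| ≤ b)
    (hbR : b ^ 2 ≤ R)
    (hR : ∀ t < T, ∑ i ∈ Finset.range t, (w t ⬝ᵥ x i) ^ 2 ≤ R)
    (hwx : ∀ t < T, (w t ⬝ᵥ x t) ^ 2 ≤ R) :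
    ∑ t ∈ Finset.range T, (w t ⬝ᵥ x t) ^ 2 ≤ 4 * R * (d * Real.log (d + T * d ^ 2)) := by
  have hd' : (1 : ℝ) ≤ d := by exact_mod_cast hd
  have hn' : (Fintype.card n : ℝ) ≤ d := by exact_mod_cast hn
  have hR0 : 0 ≤ R := (sq_nonneg b).trans hbR
  -- This regularization makes `l * ‖w‖² ≤ b² ≤ R`, so it costs no more than the bound on the past.
  set l : ℝ := 1 / d with hldef
  have hl : 0 < l := by positivity
  have hld : l * d = 1 := by rw [hldef]; field_simp
  set q : ℕ → ℝ := fun t => x t ⬝ᵥ (gram l x t)⁻¹ *ᵥ x t with hq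
  have hq0 : ∀ t, 0 ≤ q t := fun t => by
    simpa using (posDef_gram hl x t).inv.posSemidef.dotProduct_mulVec_nonneg (x t)
  have hstep : ∀ t < T, (w t ⬝ᵥ x t) ^ 2 ≤ 2 * R * (2 * Real.log (1 + q t)) := by
    intro t ht
    have h1 := dotProduct_sq_le_of_posDef (posDef_gram hl x t) (w t) (x t)
    have h2 : w t ⬝ᵥ gram l x t *ᵥ w t ≤ 2 * R := by
      rw [dotProduct_gram]
      have h3 := dotProduct_self_le (hw t)
      have h4 : l * (w t ⬝ᵥ w t) ≤ b ^ 2 := by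
        calc l * (w t ⬝ᵥ w t) ≤ l * (d * b ^ 2) := by gcongr; exact h3.trans (by gcongr)
          _ = b ^ 2 := by rw [← mul_assoc, hld, one_mul]
      linarith [hR t ht]
    have h3 : (w t ⬝ᵥ x t) ^ 2 ≤ 2 * R * q t := h1.trans (by gcongr; exact hq0 t)
    -- The logarithm dominates only the truncation of `q t` at `1`; where `q t` is large, the a
    -- priori bound `hwx` takes over.
    have h4 : (w t ⬝ᵥ x t) ^ 2 ≤ 2 * R * min 1 (q t) := by
      rcases min_choice 1 (q t) with h | h <;> rw [h]
      · linarith [hwx t ht]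
      · exact h3
    exact h4.trans (by gcongr; exact min_one_le_two_mul_log (hq0 t))
  have hdet0 : (gram l x 0).det = l ^ Fintype.card n := by simp [gram]
  have htr : (gram l x T).trace ≤ l * (d + T * d ^ 2) := by
    rw [trace_gram]
    have h1 : ∑ i ∈ Finset.range T, x i ⬝ᵥ x i ≤ T * d := by
      calc ∑ i ∈ Finset.range T, x i ⬝ᵥ x i ≤ ∑ _i ∈ Finset.range T, (d : ℝ) :=
            Finset.sum_le_sum fun i _ => (dotProduct_self_le (hx i)).trans (by simpa using hn')
        _ = _ := by simp
    have h2 : l * (T * (d : ℝ) ^ 2) = T * d := by rw [hldef]; field_simp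
    rw [mul_add, h2]
    gcongr
  have hlog : Real.log (gram l x T).det - Real.log (gram l x 0).det
      ≤ d * Real.log (d + T * d ^ 2) := by
    have hA : 0 < (d : ℝ) + T * d ^ 2 := by positivity
    have h1 : (gram l x T).det ≤ (l * (d + T * d ^ 2)) ^ Fintype.card n :=
      (det_le_trace_pow (posDef_gram hl x T).posSemidef).trans
        (pow_le_pow_left₀ (posDef_gram hl x T).posSemidef.trace_nonneg htr _)
    have h2 := Real.log_le_log (posDef_gram hl x T).det_pos h1
    rw [Real.log_pow, Real.log_mul hl.ne' hA.ne'] at h2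
    rw [hdet0, Real.log_pow]
    have h3 : (Fintype.card n : ℝ) * Real.log (d + T * d ^ 2) ≤ d * Real.log (d + T * d ^ 2) := by
      refine mul_le_mul_of_nonneg_right hn' (Real.log_nonneg ?_)
      have : (0 : ℝ) ≤ T * d ^ 2 := by positivity
      linarith
    linarith
  calc ∑ t ∈ Finset.range T, (w t ⬝ᵥ x t) ^ 2
      ≤ ∑ t ∈ Finset.range T, 2 * R * (2 * Real.log (1 + q t)) :=
        Finset.sum_le_sum fun t ht => hstep t (Finset.mem_range.1 ht)
    _ = 4 * R * ∑ t ∈ Finset.range T, Real.log (1 + q t) := by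
        rw [Finset.mul_sum]; exact Finset.sum_congr rfl fun _ _ => by ring
    _ ≤ _ := by
        rw [sum_log_gram hl]
        gcongr

/-- The elliptic potential lemma for a finite bilinear family of rank at most `d`, without any
bound on the norms of the vectors. -/
theorem sum_inner_sq_le {ι : Type*} [Finite ι] {d T : ℕ} (W X : ι → EuclideanSpace ℝ (Fin d))
    {b R : ℝ} (hd : 1 ≤ d) (hb : ∀ g f, |inner ℝ (W g) (X f)| ≤ b) (hbR : b ^ 2 ≤ R)
    (f : ℕ → ι)
    (hR : ∀ t < T, ∑ i ∈ Finset.range t, (inner ℝ (W (f t)) (X (f i)) : ℝ) ^ 2 ≤ R) :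
    ∑ t ∈ Finset.range T, (inner ℝ (W (f t)) (X (f t)) : ℝ) ^ 2
      ≤ 4 * R * (d * Real.log (d + T * d ^ 2)) := by
  -- In spanner coordinates `X k` becomes `c k` with entries in `[-1, 1]`, and `W g` becomes the
  -- vector of its products with the spanner. These are values of the bilinear form, hence bounded
  -- by `b`.
  obtain ⟨r, hr, φ, c, hc, h⟩ := exists_barycentric_spanner X
  rw [finrank_euclideanSpace_fin] at hr
  have key : ∀ g k, (inner ℝ (W g) (X k) : ℝ) = (fun j => inner ℝ (W g) (X (φ j))) ⬝ᵥ c k := by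
    intro g k
    conv_lhs => rw [h k]
    simp [inner_sum, inner_smul_right, dotProduct, mul_comm]
  have := sum_dotProduct_sq_le (x := fun t => c (f t))
    (w := fun t j => inner ℝ (W (f t)) (X (φ j))) (T := T) (b := b) (R := R) hd
    (by simpa using hr) (fun t j => hc _ _) (fun t j => hb _ _) hbR
    (fun t ht => by simpa only [← key] using hR t ht)
    (fun t _ => by
      rw [← key, ← sq_abs]
      exact (pow_le_pow_left₀ (abs_nonneg _) (hb _ _) 2).trans hbR)
  simpa only [← key] using this

end LinearAlgebra

/-! ### One-step concentration for least squares losses -/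

section Concentration

/-- The integral against a probability measure of a function with values in `[-B, B]`. -/
theorem abs_integral_le_of_abs_le {Z : Type*} [MeasurableSpace Z] (ν : Measure Z)
    [IsProbabilityMeasure ν] {u : Z → ℝ} {B : ℝ} (huB : ∀ z, |u z| ≤ B) :
    |∫ z, u z ∂ν| ≤ B := by
  have := norm_integral_le_of_norm_le_const (μ := ν) (f := u) (C := B) (.of_forall huB)
  simpa using this

theorem integrable_of_abs_le {Z : Type*} [MeasurableSpace Z] (ν : Measure Z)
    [IsFiniteMeasure ν] {u : Z → ℝ} {B : ℝ} (hu : Measurable u) (huB : ∀ z, |u z| ≤ B) :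
    Integrable u ν :=
  Integrable.of_bound hu.aestronglyMeasurable B (.of_forall huB)

/-- Hoeffding's lemma for a centered bounded variable. -/
theorem lintegral_exp_mul_sub_integral_le {Z : Type*} [MeasurableSpace Z] (ν : Measure Z)
    [IsProbabilityMeasure ν] {u : Z → ℝ} {B : ℝ} (hu : Measurable u) (huB : ∀ z, |u z| ≤ B)
    (s : ℝ) :
    ∫⁻ z, ENNReal.ofReal (Real.exp (s * (u z - ∫ z', u z' ∂ν))) ∂ν
      ≤ ENNReal.ofReal (Real.exp (B ^ 2 * s ^ 2 / 2)) := by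
  have hB : 0 ≤ B := by
    obtain ⟨z⟩ : Nonempty Z := ν.nonempty_of_neZero
    exact (abs_nonneg _).trans (huB z)
  have h := hasSubgaussianMGF_of_mem_Icc (μ := ν) (a := -B) (b := B) hu.aemeasurable
    (.of_forall fun z => abs_le.1 (huB z))
  rw [← ofReal_integral_eq_lintegral_ofReal (h.integrable_exp_mul s)
    (.of_forall fun z => (Real.exp_pos _).le)]
  refine ENNReal.ofReal_le_ofReal ((h.mgf_le s).trans_eq ?_)
  congr 3
  simp only [NNReal.coe_pow, NNReal.coe_div, coe_nnnorm, Real.norm_eq_abs, NNReal.coe_ofNat]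
  rw [abs_of_nonneg (by linarith)]
  ring

/-- An affine bound can be integrated over the roll-in distribution, which turns pointwise squared
errors into their mean. -/
theorem exp_neg_le_one_sub_half {y : ℝ} (h0 : 0 ≤ y) (h1 : y ≤ 1) :
    Real.exp (-y) ≤ 1 - y / 2 := by
  have h2 : 1 ≤ (1 - y / 2) * Real.exp y := by
    have h3 := mul_le_mul_of_nonneg_left (Real.quadratic_le_exp_of_nonneg h0)
      (show 0 ≤ 1 - y / 2 by linarith)
    nlinarith [mul_nonneg h0 (mul_nonneg (sub_nonneg.2 h1) (by linarith : 0 ≤ 1 + y))]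
  rw [Real.exp_neg, inv_le_iff_one_le_mul₀ (Real.exp_pos y)]
  exact h2

variable {Y Z : Type*} [MeasurableSpace Y] [MeasurableSpace Z]

theorem measurable_integral_kernel (κ : Kernel Y Z) [IsSFiniteKernel κ] {u : Y × Z → ℝ}
    (hu : Measurable u) : Measurable fun y => ∫ z, u (y, z) ∂(κ y) :=
  (hu.stronglyMeasurable.integral_kernel_prod_right' (κ := κ)).measurable

/-- The exponential moment bound behind the confidence region: the excess least squares loss of a
wrong kernel `Q` over the true kernel `P` dominates a multiple of its mean squared error, up to a
supermartingale. -/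
theorem lintegral_exp_excess_loss_le (μ : Measure Y) [IsProbabilityMeasure μ] (P Q : Kernel Y Z)
    [IsMarkovKernel P] [IsMarkovKernel Q] {u : Y × Z → ℝ} {B : ℝ} (hB : 0 < B)
    (hu : Measurable u) (huB : ∀ x, |u x| ≤ B) :
    ∫⁻ x, ENNReal.ofReal (Real.exp (
      (∫ y, ((∫ z, u (y, z) ∂(Q y)) - ∫ z, u (y, z) ∂(P y)) ^ 2 ∂μ) / (16 * B ^ 2)
      - (((∫ z, u (x.1, z) ∂(Q x.1)) - u x) ^ 2 - ((∫ z, u (x.1, z) ∂(P x.1)) - u x) ^ 2)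
        / (4 * B ^ 2))) ∂(μ ⊗ₘ P) ≤ 1 := by
  have hP := measurable_integral_kernel P hu
  have hQ := measurable_integral_kernel Q hu
  set p : Y → ℝ := fun y => ∫ z, u (y, z) ∂(P y) with hp
  set q : Y → ℝ := fun y => ∫ z, u (y, z) ∂(Q y) with hq
  set m : ℝ := ∫ y, (q y - p y) ^ 2 ∂μ with hm
  have hpB : ∀ y, |p y| ≤ B := fun y => abs_integral_le_of_abs_le _ fun z => huB _
  have hqB : ∀ y, |q y| ≤ B := fun y => abs_integral_le_of_abs_le _ fun z => huB _
  have hD : ∀ y, (q y - p y) ^ 2 ≤ 4 * B ^ 2 := fun y => by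
    have h1 := abs_le.1 (hpB y)
    have h2 := abs_le.1 (hqB y)
    nlinarith
  have hDi : Integrable (fun y => (q y - p y) ^ 2) μ :=
    integrable_of_abs_le μ ((hQ.sub hP).pow_const 2) (B := 4 * B ^ 2) fun y => by
      rw [abs_of_nonneg (sq_nonneg _)]; exact hD y
  have hmeas : ∀ p q : Y → ℝ, Measurable p → Measurable q → Measurable fun x : Y × Z =>
      ENNReal.ofReal (Real.exp (m / (16 * B ^ 2)
        - ((q x.1 - u x) ^ 2 - (p x.1 - u x) ^ 2) / (4 * B ^ 2))) := by
    intro p q hp hq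
    fun_prop
  rw [Measure.lintegral_compProd (hmeas p q hP hQ)]
  -- Conditionally on `y`, the excess loss is `(q - p)² - 2(q - p)(u - p)`. With the scale `1 / (4 *
  -- B ^ 2)`, Hoeffding's lemma for the linear term gives back `(q - p)² / (8 * B ^ 2)`, half of
  -- what the quadratic term provides.
  have hinner : ∀ y, ∫⁻ z, ENNReal.ofReal (Real.exp (m / (16 * B ^ 2)
      - ((q y - u (y, z)) ^ 2 - (p y - u (y, z)) ^ 2) / (4 * B ^ 2))) ∂(P y)
      ≤ ENNReal.ofReal (Real.exp (m / (16 * B ^ 2)) * (1 - (q y - p y) ^ 2 / (16 * B ^ 2))) := by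
    intro y
    have huy : Measurable fun z => u (y, z) := hu.comp measurable_prodMk_left
    have h1 := lintegral_exp_mul_sub_integral_le (P y) huy (fun z => huB _)
      ((q y - p y) / (2 * B ^ 2))
    have h2 : ∀ z, ENNReal.ofReal (Real.exp (m / (16 * B ^ 2)
        - ((q y - u (y, z)) ^ 2 - (p y - u (y, z)) ^ 2) / (4 * B ^ 2)))
        = ENNReal.ofReal (Real.exp (m / (16 * B ^ 2) - (q y - p y) ^ 2 / (4 * B ^ 2)))
          * ENNReal.ofReal (Real.exp ((q y - p y) / (2 * B ^ 2) * (u (y, z) - p y))) := by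
      intro z
      rw [← ENNReal.ofReal_mul (Real.exp_pos _).le, ← Real.exp_add]
      congr 2
      field_simp
      ring
    simp_rw [h2]
    rw [lintegral_const_mul _ (by fun_prop)]
    refine (mul_le_mul_right h1 _).trans ?_
    rw [← ENNReal.ofReal_mul (Real.exp_pos _).le, ← Real.exp_add]
    refine ENNReal.ofReal_le_ofReal ?_
    have h3 : m / (16 * B ^ 2) - (q y - p y) ^ 2 / (4 * B ^ 2)
        + B ^ 2 * ((q y - p y) / (2 * B ^ 2)) ^ 2 / 2
        = m / (16 * B ^ 2) + -((q y - p y) ^ 2 / (8 * B ^ 2)) := by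
      field_simp
      ring
    rw [h3, Real.exp_add]
    gcongr
    have h4 := exp_neg_le_one_sub_half (y := (q y - p y) ^ 2 / (8 * B ^ 2)) (by positivity)
      (by rw [div_le_one (by positivity)]; nlinarith [hD y])
    refine h4.trans_eq ?_
    field_simp
    ring
  refine (lintegral_mono hinner).trans ?_
  have hnn : ∀ y, 0 ≤ Real.exp (m / (16 * B ^ 2)) * (1 - (q y - p y) ^ 2 / (16 * B ^ 2)) := by
    intro y
    refine mul_nonneg (Real.exp_pos _).le (sub_nonneg.2 ?_)
    rw [div_le_one (by positivity)]
    nlinarith [hD y]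
  have hi : Integrable (fun y => 1 - (q y - p y) ^ 2 / (16 * B ^ 2)) μ :=
    (integrable_const _).sub (hDi.div_const _)
  rw [← ofReal_integral_eq_lintegral_ofReal (hi.const_mul _) (.of_forall hnn),
    integral_const_mul, integral_sub (integrable_const _) (hDi.div_const _), integral_div,
    ← ENNReal.ofReal_one]
  refine ENNReal.ofReal_le_ofReal ?_
  rw [← hm]
  simp only [integral_const, probReal_univ, smul_eq_mul, mul_one]
  -- The averaged factor `1 - m / (16 * B ^ 2)` is at most the exponential that cancels the
  -- prefactor.
  have := Real.add_one_le_exp (-(m / (16 * B ^ 2)))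
  calc Real.exp (m / (16 * B ^ 2)) * (1 - m / (16 * B ^ 2))
      ≤ Real.exp (m / (16 * B ^ 2)) * Real.exp (-(m / (16 * B ^ 2))) := by
        gcongr; linarith
    _ = 1 := by rw [← Real.exp_add, add_neg_cancel, Real.exp_zero]

end Concentration

/-! ### Numerical estimates -/

section Numeric

theorem log_one_add_le_sqrt {x : ℝ} (hx : 0 ≤ x) : Real.log (1 + x) ≤ 2 * √x := by
  have h1 : 1 + x ≤ (1 + √x) ^ 2 := by nlinarith [Real.sq_sqrt hx, Real.sqrt_nonneg x]
  have h2 := Real.log_le_log (by positivity) h1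
  rw [Real.log_pow] at h2
  have h3 := Real.log_le_sub_one_of_pos (show 0 < 1 + √x by positivity)
  push_cast at h2
  linarith

/-- Inverting `x ≥ C K log (2 + K)`. -/
theorem mul_log_le_of_mul_log_le {K x : ℝ} (hK : 0 ≤ K) (hx : 0 ≤ x)
    (h : 2304 * K * Real.log (2 + K) ≤ x) : 128 * K * Real.log (1 + x) ≤ x := by
  by_contra! hlt
  have h1 := log_one_add_le_sqrt hx
  have hs := Real.sqrt_nonneg x
  have hs2 := Real.sq_sqrt hx
  have hx0 : 0 < √x := by
    refine Real.sqrt_pos.2 (lt_of_le_of_ne hx fun h0 => ?_)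
    rw [← h0] at hlt
    simp at hlt
  -- Bootstrapping: the crude bound `log (1 + x) ≤ 2√x` already makes `x` polynomial in `K`. Hence
  -- `log (1 + x) ≤ 18 * log (2 + K)`, and `128 * 18 = 2304`.
  have h2 : √x < 256 * K := by
    by_contra! h3
    have : 128 * K * Real.log (1 + x) ≤ 128 * K * (2 * √x) := by gcongr
    nlinarith
  have h3 : 1 + x ≤ (2 + K) ^ 18 := by
    have h4 : x ≤ (256 * K) ^ 2 := by
      rw [← hs2]; exact pow_le_pow_left₀ hs h2.le 2
    have h5 : (2 : ℝ) ^ 16 ≤ (2 + K) ^ 16 := pow_le_pow_left₀ (by norm_num) (by linarith) 16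
    have h6 : (2 : ℝ) ^ 16 * (2 + K) ^ 2 ≤ (2 + K) ^ 16 * (2 + K) ^ 2 := by gcongr
    calc 1 + x ≤ 1 + (256 * K) ^ 2 := by linarith
      _ ≤ (2 : ℝ) ^ 16 * (2 + K) ^ 2 := by nlinarith
      _ ≤ (2 + K) ^ 16 * (2 + K) ^ 2 := h6
      _ = (2 + K) ^ 18 := by ring
  have h4 := Real.log_le_log (by positivity) h3
  rw [Real.log_pow] at h4
  push_cast at h4
  have h5 : 128 * K * Real.log (1 + x) ≤ 128 * K * (18 * Real.log (2 + K)) := by gcongr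
  linarith

/-- A self-consistent number of iterations. -/
theorem exists_nat_mul_log_le {C a L : ℝ} (hC : 0 ≤ C) (ha : 0 ≤ a) (hL : 0 ≤ L) :
    ∃ T : ℕ, 1 ≤ T ∧
      C * (a * (Real.log T + L)) * Real.log (2 + a * (Real.log T + L)) ≤ T ∧
      (T : ℝ) ≤ 1 + C * (a * (Real.log T + L)) * Real.log (2 + a * (Real.log T + L)) := by
  classical
  set F : ℕ → ℝ := fun T =>
    C * (a * (Real.log T + L)) * Real.log (2 + a * (Real.log T + L)) with hF
  have hlog : ∀ T : ℕ, 0 ≤ Real.log T := fun T => Real.log_natCast_nonneg T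
  -- `F T` grows at most like `(log T)²`, which is `o(T)`.
  have hex : ∃ T : ℕ, 1 ≤ T ∧ F T ≤ T := by
    set E : ℝ := C * (a * (1 + L)) * (1 + a * (1 + L)) with hE
    have hE0 : 0 ≤ E := by positivity
    have ho := (Real.isLittleO_pow_log_id_atTop (n := 2)).comp_tendsto tendsto_natCast_atTop_atTop
    obtain ⟨T, hT, hT3⟩ := ((ho.def (c := 1 / (E + 1)) (by positivity)).and
      (Filter.eventually_ge_atTop 3)).exists
    refine ⟨T, by omega, ?_⟩
    have hT3' : (3 : ℝ) ≤ T := by exact_mod_cast hT3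
    have hl1 : 1 ≤ Real.log T := by
      rw [Real.le_log_iff_exp_le (by linarith)]
      exact Real.exp_one_lt_d9.le.trans (by linarith)
    have hT' : (E + 1) * Real.log T ^ 2 ≤ T := by
      have h1 : Real.log T ^ 2 ≤ 1 / (E + 1) * T := by simpa using hT
      calc (E + 1) * Real.log T ^ 2 ≤ (E + 1) * (1 / (E + 1) * T) := by gcongr
        _ = T := by field_simp
    have hK0 : 0 ≤ a * (Real.log T + L) := by positivity
    have h2 : a * (Real.log T + L) ≤ a * (1 + L) * Real.log T := by
      rw [mul_assoc]; gcongr; nlinarith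
    have h3 : Real.log (2 + a * (Real.log T + L)) ≤ (1 + a * (1 + L)) * Real.log T := by
      have := Real.log_le_sub_one_of_pos (show 0 < 2 + a * (Real.log T + L) by positivity)
      nlinarith
    have h4 : 0 ≤ Real.log (2 + a * (Real.log T + L)) := Real.log_nonneg (by linarith)
    calc F T ≤ C * (a * (1 + L) * Real.log T) * ((1 + a * (1 + L)) * Real.log T) := by
          simp only [hF]; gcongr
      _ = E * Real.log T ^ 2 := by rw [hE]; ring
      _ ≤ T := by nlinarith [sq_nonneg (Real.log T)]
  -- For the least solution `k + 1` with `k ≥ 1`, the failure at `k` and monotonicity give `k < F k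
  -- ≤ F (k + 1)`. For `k = 0`, nonnegativity of `F` is enough.
  refine ⟨Nat.find hex, (Nat.find_spec hex).1, (Nat.find_spec hex).2, ?_⟩
  have hmono : ∀ T : ℕ, 1 ≤ T → F T ≤ F (T + 1) := by
    intro T hT
    have h1 : Real.log T ≤ Real.log (T + 1 : ℕ) :=
      Real.log_le_log (by exact_mod_cast hT) (by push_cast; linarith)
    have h2 := hlog T
    have h3 : 0 ≤ a * (Real.log T + L) := by positivity
    have h4 : 0 ≤ Real.log (2 + a * (Real.log T + L)) := Real.log_nonneg (by linarith)
    have h5 : a * (Real.log T + L) ≤ a * (Real.log (T + 1 : ℕ) + L) := by gcongr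
    have h6 : Real.log (2 + a * (Real.log T + L)) ≤ Real.log (2 + a * (Real.log (T + 1 : ℕ) + L)) :=
      Real.log_le_log (by linarith) (by linarith)
    exact mul_le_mul (mul_le_mul_of_nonneg_left h5 hC) h6 h4 (by have := h3.trans h5; positivity)
  have hF0 : ∀ T : ℕ, 0 ≤ F T := fun T => by
    have h2 := hlog T
    have h3 : 0 ≤ a * (Real.log T + L) := by positivity
    have h4 : 0 ≤ Real.log (2 + a * (Real.log T + L)) := Real.log_nonneg (by linarith)
    positivity
  change ((Nat.find hex : ℕ) : ℝ) ≤ 1 + F (Nat.find hex)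
  obtain ⟨k, hk⟩ : ∃ k, Nat.find hex = k + 1 :=
    ⟨Nat.find hex - 1, by have := (Nat.find_spec hex).1; omega⟩
  rw [hk]
  rcases Nat.eq_zero_or_pos k with rfl | hk0
  · have := hF0 (0 + 1); push_cast; simpa using this
  · have h := Nat.find_min hex (m := k) (by omega)
    have h' : (k : ℝ) < F k := by
      by_contra! hle; exact h ⟨hk0, hle⟩
    have := hmono k hk0
    push_cast
    linarith

end Numeric

/-! ### Sequential sampling -/

section Snoc

variable {α : Type*} [MeasurableSpace α] {n : ℕ}

theorem measurable_snoc :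
    Measurable fun x : (Fin n → α) × α => (Fin.snoc x.1 x.2 : Fin (n + 1) → α) := by
  refine measurable_pi_iff.2 fun i => ?_
  induction i using Fin.lastCases with
  | last => simpa using measurable_snd
  | cast i =>
    simp only [Fin.snoc_castSucc]
    exact (measurable_pi_apply i).comp measurable_fst

theorem measurable_snoc_left (p : Fin n → α) :
    Measurable fun a => (Fin.snoc p a : Fin (n + 1) → α) :=
  measurable_snoc.comp measurable_prodMk_left

/-- Without this measurability, `Measure.bind` would not compute as an iterated integral. -/
theorem measurable_map_snoc (κ : Kernel (Fin n → α) α) [IsSFiniteKernel κ] :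
    Measurable fun p => (κ p).map fun a => (Fin.snoc p a : Fin (n + 1) → α) := by
  have h : (fun p => (κ p).map fun a => (Fin.snoc p a : Fin (n + 1) → α))
      = ((Kernel.id ×ₖ κ).map fun x : (Fin n → α) × α => (Fin.snoc x.1 x.2 : Fin (n + 1) → α)) := by
    funext p
    ext s hs
    rw [Kernel.map_apply' _ measurable_snoc _ hs,
      Kernel.id_prod_apply' _ _ (measurable_snoc hs),
      Measure.map_apply (measurable_snoc_left p) hs]
    rfl
  rw [h]
  exact Kernel.measurable _

theorem lintegral_bind_map_snoc (μ : Measure (Fin n → α)) (κ : Kernel (Fin n → α) α)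
    [IsSFiniteKernel κ] {F : (Fin (n + 1) → α) → ENNReal} (hF : Measurable F) :
    ∫⁻ q, F q ∂(μ.bind fun p => (κ p).map fun a => (Fin.snoc p a : Fin (n + 1) → α))
      = ∫⁻ p, ∫⁻ a, F (Fin.snoc p a) ∂(κ p) ∂μ := by
  rw [Measure.lintegral_bind (measurable_map_snoc κ).aemeasurable hF.aemeasurable]
  refine lintegral_congr fun p => ?_
  rw [lintegral_map hF (measurable_snoc_left p)]

theorem map_init_bind_map_snoc (μ : Measure (Fin n → α)) (κ : Kernel (Fin n → α) α)
    [IsMarkovKernel κ] :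
    (μ.bind fun p => (κ p).map fun a => (Fin.snoc p a : Fin (n + 1) → α)).map
      (fun q i => q i.castSucc) = μ := by
  refine Measure.ext_of_lintegral _ fun F hF => ?_
  have hm : Measurable fun (q : Fin (n + 1) → α) (i : Fin n) => q i.castSucc := by fun_prop
  rw [lintegral_map hF hm, lintegral_bind_map_snoc _ _ (by fun_prop)]
  simp

theorem map_last_bind_map_snoc (μ : Measure (Fin n → α)) (κ : Kernel (Fin n → α) α)
    [IsMarkovKernel κ] :
    (μ.bind fun p => (κ p).map fun a => (Fin.snoc p a : Fin (n + 1) → α)).map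
      (fun q => q (Fin.last n)) = μ.bind κ := by
  refine Measure.ext_of_lintegral _ fun F hF => ?_
  rw [lintegral_map hF (by fun_prop), lintegral_bind_map_snoc _ _ (by fun_prop),
    Measure.lintegral_bind κ.aemeasurable hF.aemeasurable]
  simp

theorem isProbabilityMeasure_bind_map_snoc (μ : Measure (Fin n → α)) [IsProbabilityMeasure μ]
    (κ : Kernel (Fin n → α) α) [IsMarkovKernel κ] :
    IsProbabilityMeasure
      (μ.bind fun p => (κ p).map fun a => (Fin.snoc p a : Fin (n + 1) → α)) := by
  constructor
  rw [← lintegral_one, lintegral_bind_map_snoc _ _ measurable_const]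
  simp

theorem integral_bind_kernel {Y Z : Type*} [MeasurableSpace Y] [MeasurableSpace Z] (μ : Measure Y)
    [IsProbabilityMeasure μ] (κ : Kernel Y Z) [IsMarkovKernel κ] {f : Z → ℝ} {B : ℝ}
    (hf : Measurable f) (hB : ∀ z, |f z| ≤ B) :
    ∫ z, f z ∂(μ.bind κ) = ∫ y, ∫ z, f z ∂(κ y) ∂μ := by
  have h1 : μ.bind κ = (μ ⊗ₘ κ).map Prod.snd := (Measure.snd_compProd μ κ).symm
  rw [h1, integral_map measurable_snd.aemeasurable hf.aestronglyMeasurable,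
    Measure.integral_compProd (f := fun x => f x.2)
      (integrable_of_abs_le _ (hf.comp measurable_snd) fun x => hB x.2)]

end Snoc

/-! ### Laws of states and the values of policies -/

section Values

variable {S : Type u} {A : Type v} {H : ℕ} [MeasurableSpace S] [MeasurableSpace A]

/-- The one-step kernel of the model `P` under the policy `π`. -/
noncomputable def policyKernel (P : Transition S A H) {π : Policy S A H} (hπ : IsPolicy π)
    (h : Fin H) : Kernel S S :=
  (P h).comap (fun s => (s, π h s)) (measurable_id.prodMk (hπ h))

instance (P : Transition S A H) [∀ h, IsMarkovKernel (P h)] {π : Policy S A H} (hπ : IsPolicy π)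
    (h : Fin H) : IsMarkovKernel (policyKernel P hπ h) := by
  unfold policyKernel; infer_instance

theorem policyKernel_apply (P : Transition S A H) {π : Policy S A H} (hπ : IsPolicy π)
    (h : Fin H) (s : S) : policyKernel P hπ h s = P h (s, π h s) := rfl

/-- The law of the state `s_{n+1}`, including the terminal one. -/
noncomputable def stateLawAt (P : Transition S A H) (π : Policy S A H) (s₁ : S) (n : ℕ)
    (hn : n ≤ H) : Measure S :=
  (pathLaw P π s₁ n hn).map fun p => p (Fin.last n)

theorem stateLaw_eq_stateLawAt (P : Transition S A H) (π : Policy S A H) (s₁ : S) (h : Fin H) :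
    stateLaw P π s₁ h = stateLawAt P π s₁ h h.2.le := rfl

theorem pathLaw_succ (P : Transition S A H) {π : Policy S A H} (hπ : IsPolicy π) (s₁ : S)
    (n : ℕ) (hn : n + 1 ≤ H) :
    pathLaw P π s₁ (n + 1) hn
      = (pathLaw P π s₁ n (Nat.le_of_succ_le hn)).bind fun p =>
        ((policyKernel P hπ ⟨n, hn⟩).comap (fun p : Fin (n + 1) → S => p (Fin.last n))
          (measurable_pi_apply _) p).map
          fun s' => (Fin.snoc p s' : Fin (n + 1 + 1) → S) := rfl

theorem stateLawAt_zero (P : Transition S A H) (π : Policy S A H) (s₁ : S) : stateLawAt P π s₁ 0 (Nat.zero_le H) = Measure.dirac s₁ := by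
  exact Measure.map_dirac' (measurable_pi_apply _) _

variable (P : Transition S A H) [∀ h, IsMarkovKernel (P h)] {π : Policy S A H} (s₁ : S)

theorem isProbabilityMeasure_pathLaw (hπ : IsPolicy π) (n : ℕ) (hn : n ≤ H) :
    IsProbabilityMeasure (pathLaw P π s₁ n hn) := by
  induction n with
  | zero => rw [pathLaw]; infer_instance
  | succ n ih =>
    have := ih (Nat.le_of_succ_le hn)
    rw [pathLaw_succ P hπ]
    exact isProbabilityMeasure_bind_map_snoc _ _

theorem isProbabilityMeasure_stateLawAt (hπ : IsPolicy π) (n : ℕ) (hn : n ≤ H) :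
    IsProbabilityMeasure (stateLawAt P π s₁ n hn) := by
  have := isProbabilityMeasure_pathLaw P s₁ hπ n hn
  exact Measure.isProbabilityMeasure_map (measurable_pi_apply _).aemeasurable

theorem stateLawAt_succ (hπ : IsPolicy π) (n : ℕ) (hn : n + 1 ≤ H) :
    stateLawAt P π s₁ (n + 1) hn
      = (stateLawAt P π s₁ n (Nat.le_of_succ_le hn)).bind (policyKernel P hπ ⟨n, hn⟩) := by
  rw [stateLawAt, pathLaw_succ P hπ, map_last_bind_map_snoc]
  refine Measure.ext_of_lintegral _ fun F hF => ?_
  rw [Measure.lintegral_bind (Kernel.aemeasurable _) hF.aemeasurable,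
    Measure.lintegral_bind (Kernel.aemeasurable _) hF.aemeasurable, stateLawAt,
    lintegral_map hF.lintegral_kernel (measurable_pi_apply _)]
  rfl

/-- Appending later states does not change the law of the earlier ones. The reward of a full path
can thus be integrated one step at a time. -/
theorem map_pathLaw_apply (hπ : IsPolicy π) (n : ℕ) (hn : n ≤ H) (k : Fin (n + 1)) :
    (pathLaw P π s₁ n hn).map (fun p => p k)
      = stateLawAt P π s₁ k ((Nat.le_of_lt_succ k.2).trans hn) := by
  induction n with
  | zero =>
    obtain rfl : k = 0 := Fin.fin_one_eq_zero k
    rfl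
  | succ n ih =>
    induction k using Fin.lastCases with
    | last => rfl
    | cast i =>
      have h := ih (Nat.le_of_succ_le hn) i
      rw [← map_init_bind_map_snoc (pathLaw P π s₁ n (Nat.le_of_succ_le hn))
        ((policyKernel P hπ ⟨n, hn⟩).comap (fun p : Fin (n + 1) → S => p (Fin.last n))
          (measurable_pi_apply _)), Measure.map_map (by fun_prop) (by fun_prop),
        ← pathLaw_succ P hπ] at h
      exact h

variable {P}

theorem value_eq_sum (hπ : IsPolicy π) {r : Reward S A H} (hr : IsReward P r s₁) :
    value P r s₁ π = ∑ h : Fin H, ∫ s, r h s (π h s) ∂(stateLaw P π s₁ h) := by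
  have := isProbabilityMeasure_pathLaw P s₁ hπ H le_rfl
  have hm : ∀ h, Measurable fun s => r h s (π h s) := fun h =>
    (hr.measurable h).comp (measurable_id.prodMk (hπ h))
  have hb : ∀ h s, |r h s (π h s)| ≤ 1 := fun h s => by
    rw [abs_of_nonneg (hr.nonneg _ _ _)]; exact hr.le_one _ _ _
  simp only [value, totalReward]
  rw [integral_finsetSum]
  · refine Finset.sum_congr rfl fun h _ => ?_
    have h1 := map_pathLaw_apply P s₁ hπ H le_rfl h.castSucc
    rw [stateLaw_eq_stateLawAt]
    have h2 : stateLawAt P π s₁ h h.2.le = (pathLaw P π s₁ H le_rfl).map fun p => p h.castSucc :=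
      h1.symm
    rw [h2, integral_map (measurable_pi_apply _).aemeasurable (hm h).aestronglyMeasurable]
  · exact fun h _ => integrable_of_abs_le _ ((hm h).comp (measurable_pi_apply _)) fun p => hb _ _

theorem value_nonneg (hπ : IsPolicy π) {r : Reward S A H} (hr : IsReward P r s₁) : 0 ≤ value P r s₁ π := by
  rw [value_eq_sum s₁ hπ hr]
  exact Finset.sum_nonneg fun h _ => integral_nonneg fun s => hr.nonneg _ _ _

theorem value_le_one (hπ : IsPolicy π) {r : Reward S A H} (hr : IsReward P r s₁) : value P r s₁ π ≤ 1 := by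
  have := isProbabilityMeasure_pathLaw P s₁ hπ H le_rfl
  have hm : ∀ h, Measurable fun s => r h s (π h s) := fun h =>
    (hr.measurable h).comp (measurable_id.prodMk (hπ h))
  have hb : ∀ h s, |r h s (π h s)| ≤ 1 := fun h s => by
    rw [abs_of_nonneg (hr.nonneg _ _ _)]; exact hr.le_one _ _ _
  have hi : Integrable (totalReward r π) (pathLaw P π s₁ H le_rfl) :=
    integrable_finsetSum _ fun h _ =>
      integrable_of_abs_le _ ((hm h).comp (measurable_pi_apply _)) fun p => hb _ _
  calc value P r s₁ π ≤ ∫ _p, (1 : ℝ) ∂(pathLaw P π s₁ H le_rfl) :=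
        integral_mono_ae hi (integrable_const _) (hr.total_le_one π hπ)
    _ = 1 := by simp

end Values

/-! ### Optimal value functions -/

section Optimal

variable {S : Type u} {A : Type v} {H : ℕ} [MeasurableSpace S] [MeasurableSpace A]

theorem vOpt_of_lt (Q : Transition S A H) (r : Reward S A H) (h : Fin H) (s : S) :
    vOpt Q r h s = ⨆ a : A, qOpt Q r h s a := by
  rw [vOpt, dif_pos h.2]
  rfl

theorem vOpt_self (Q : Transition S A H) (r : Reward S A H) (s : S) : vOpt Q r H s = 0 := by
  rw [vOpt, dif_neg (lt_irrefl H)]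

theorem qOpt_le_vOpt [Finite A] (Q : Transition S A H) (r : Reward S A H) (h : Fin H) (s : S)
    (a : A) : qOpt Q r h s a ≤ vOpt Q r h s := by
  rw [vOpt_of_lt]
  exact le_ciSup (Finite.bddAbove_range _) a

theorem IsGreedy.vOpt_eq [Finite A] {Q : Transition S A H} {r : Reward S A H} {π : Policy S A H}
    (hπ : IsGreedy Q r π) (h : Fin H) (s : S) : vOpt Q r h s = qOpt Q r h s (π h s) := by
  refine le_antisymm ?_ (qOpt_le_vOpt _ _ _ _ _)
  rw [vOpt_of_lt]
  have : Nonempty A := ⟨π h s⟩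
  exact ciSup_le (hπ h s)

/-- Backward induction, with `k` the number of remaining steps. The bound on the total reward
concerns paths of the true model only, so for a general model each step contributes up to `1`; the
bound only serves integrability. -/
theorem vOpt_measurable_bounded [Finite A] [Nonempty A] (Q : Transition S A H)
    [∀ h, IsMarkovKernel (Q h)] {r : Reward S A H}
    (hrm : ∀ h, Measurable fun x : S × A => r h x.1 x.2) (hr0 : ∀ h s a, 0 ≤ r h s a)
    (hr1 : ∀ h s a, r h s a ≤ 1) (k h : ℕ) (hk : h + k = H) :
    Measurable (vOpt Q r h) ∧ ∀ s, |vOpt Q r h s| ≤ k := by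
  induction k generalizing h with
  | zero =>
    obtain rfl : h = H := by omega
    have h0 : vOpt Q r h = fun _ => 0 := funext fun s => vOpt_self Q r s
    rw [h0]
    exact ⟨measurable_const, fun s => by simp⟩
  | succ k ih =>
    obtain ⟨hm, hb⟩ := ih (h + 1) (by omega)
    have hh : h < H := by omega
    have hq : ∀ s, vOpt Q r h s = ⨆ a : A, qOpt Q r ⟨h, hh⟩ s a := fun s =>
      vOpt_of_lt Q r ⟨h, hh⟩ s
    refine ⟨?_, fun s => ?_⟩
    · rw [funext hq]
      refine Measurable.iSup fun a => ?_
      have h1 : Measurable fun x : S × A => ∫ s', vOpt Q r (h + 1) s' ∂(Q ⟨h, hh⟩ x) :=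
        measurable_integral_kernel (Q ⟨h, hh⟩) (u := fun x => vOpt Q r (h + 1) x.2)
          (hm.comp measurable_snd)
      exact ((hrm ⟨h, hh⟩).add h1).comp (measurable_id.prodMk measurable_const)
    · have hqb : ∀ a, |qOpt Q r ⟨h, hh⟩ s a| ≤ (k + 1 : ℕ) := fun a => by
        have h1 := abs_integral_le_of_abs_le (Q ⟨h, hh⟩ (s, a)) hb
        have h2 := abs_le.1 h1
        have h3 := hr0 ⟨h, hh⟩ s a
        have h4 := hr1 ⟨h, hh⟩ s a
        rw [qOpt, abs_le]
        push_cast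
        constructor <;> linarith
      rw [hq]
      obtain ⟨a, ha⟩ := Finite.exists_max fun a => qOpt Q r ⟨h, hh⟩ s a
      rw [show ⨆ a : A, qOpt Q r ⟨h, hh⟩ s a = qOpt Q r ⟨h, hh⟩ s a from
        le_antisymm (ciSup_le ha) (le_ciSup (Finite.bddAbove_range _) a)]
      exact hqb a

theorem measurable_vOpt [Finite A] [Nonempty A] (Q : Transition S A H)
    [∀ h, IsMarkovKernel (Q h)] {P : Transition S A H} {r : Reward S A H} {s₁ : S}
    (hr : IsReward P r s₁) {h : ℕ} (hh : h ≤ H) : Measurable (vOpt Q r h) :=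
  (vOpt_measurable_bounded Q hr.measurable hr.nonneg hr.le_one (H - h) h (by omega)).1

theorem abs_vOpt_le [Finite A] [Nonempty A] (Q : Transition S A H)
    [∀ h, IsMarkovKernel (Q h)] {P : Transition S A H} {r : Reward S A H} {s₁ : S}
    (hr : IsReward P r s₁) {h : ℕ} (hh : h ≤ H) (s : S) : |vOpt Q r h s| ≤ H :=
  ((vOpt_measurable_bounded Q hr.measurable hr.nonneg hr.le_one (H - h) h (by omega)).2 s).trans
    (by exact_mod_cast Nat.sub_le H h)

theorem modelGap_self (P : Transition S A H) (s₁ : S) (πf πg : Policy S A H) (h : Fin H) (φ : S → A → S → ℝ) :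
    modelGap P P s₁ πf πg h φ = 0 := by
  simp [modelGap]

variable {P Q : Transition S A H} [∀ h, IsMarkovKernel (Q h)]
  {r : Reward S A H} {s₁ : S} {π : Policy S A H}

theorem measurable_qOpt_policy [Finite A] [Nonempty A] (hr : IsReward P r s₁) (hπ : IsPolicy π)
    (h : Fin H) : Measurable fun s => qOpt Q r h s (π h s) := by
  have h1 : Measurable fun x : S × A => ∫ s', vOpt Q r (h + 1) s' ∂(Q h x) :=
    measurable_integral_kernel (Q h) (u := fun x => vOpt Q r (h + 1) x.2)
      ((measurable_vOpt Q hr h.2).comp measurable_snd)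
  exact ((hr.measurable h).add h1).comp (measurable_id.prodMk (hπ h))

theorem abs_qOpt_le [Finite A] [Nonempty A] (hr : IsReward P r s₁) (h : Fin H) (s : S) (a : A) :
    |qOpt Q r h s a| ≤ 1 + H := by
  have h1 := abs_integral_le_of_abs_le (Q h (s, a)) (abs_vOpt_le Q hr (h := h + 1) h.2)
  have h2 := abs_le.1 h1
  have h3 := hr.nonneg h s a
  have h4 := hr.le_one h s a
  rw [qOpt, abs_le]
  constructor <;> linarith

variable [∀ h, IsMarkovKernel (P h)]

/-- One step of the Bellman error decomposition. -/
theorem integral_qOpt_eq [Finite A] [Nonempty A] (hr : IsReward P r s₁) (hπ : IsPolicy π)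
    (h : Fin H) :
    ∫ s, qOpt Q r h s (π h s) ∂(stateLaw P π s₁ h)
      = ∫ s, r h s (π h s) ∂(stateLaw P π s₁ h)
        + modelGap P Q s₁ π π h (fun _ _ s' => vOpt Q r (h + 1) s')
        + ∫ s, vOpt Q r (h + 1) s ∂(stateLawAt P π s₁ (h + 1) h.2) := by
  have := isProbabilityMeasure_stateLawAt P s₁ hπ h h.2.le
  have hV := measurable_vOpt Q hr (h := h + 1) h.2
  have hVb := abs_vOpt_le Q hr (h := h + 1) h.2
  rw [stateLawAt_succ P s₁ hπ h h.2, integral_bind_kernel _ _ hV hVb, modelGap,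
    stateLaw_eq_stateLawAt]
  simp only [policyKernel_apply, Fin.eta]
  have hm : ∀ R : Transition S A H, (∀ h, IsMarkovKernel (R h)) →
      Integrable (fun s => ∫ s', vOpt Q r (h + 1) s' ∂(R h (s, π h s)))
        (stateLawAt P π s₁ h h.2.le) := fun R _ =>
    integrable_of_abs_le _
      ((measurable_integral_kernel (R h) (u := fun x => vOpt Q r (h + 1) x.2)
        (hV.comp measurable_snd)).comp (measurable_id.prodMk (hπ h)))
      fun s => abs_integral_le_of_abs_le _ hVb
  have hri : Integrable (fun s => r h s (π h s)) (stateLawAt P π s₁ h h.2.le) :=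
    integrable_of_abs_le _ ((hr.measurable h).comp (measurable_id.prodMk (hπ h))) (B := 1)
      fun s => by rw [abs_of_nonneg (hr.nonneg _ _ _)]; exact hr.le_one _ _ _
  simp only [qOpt]
  rw [integral_add hri (hm Q inferInstance),
    integral_sub (hm Q inferInstance) (hm P inferInstance)]
  ring

/-- The value loss of the greedy policy of a model is the sum of its Bellman errors. -/
theorem vOpt_sub_value_eq [Finite A] [Nonempty A] (hr : IsReward P r s₁) (hπ : IsPolicy π)
    (hg : IsGreedy Q r π) :
    vOpt Q r 0 s₁ - value P r s₁ π
      = ∑ h : Fin H, modelGap P Q s₁ π π h (fun _ _ s' => vOpt Q r (h + 1) s') := by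
  -- The mean of the model's value function under the true state law; its increments are reward plus
  -- Bellman error. The default `0` beyond `H` never enters the telescoping sum.
  let G : ℕ → ℝ := fun n => if hn : n ≤ H then ∫ s, vOpt Q r n s ∂(stateLawAt P π s₁ n hn) else 0
  have hG0 : G 0 = vOpt Q r 0 s₁ := by
    simp only [G, dif_pos (Nat.zero_le H), stateLawAt_zero]
    exact integral_dirac' _ _ (measurable_vOpt Q hr (Nat.zero_le H)).stronglyMeasurable
  have hGH : G H = 0 := by
    simp [G, vOpt_self]
  have hstep : ∀ h : Fin H, G h - G (h + 1) = ∫ s, r h s (π h s) ∂(stateLaw P π s₁ h)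
        + modelGap P Q s₁ π π h (fun _ _ s' => vOpt Q r (h + 1) s') := fun h => by
    have h1 := integral_qOpt_eq (Q := Q) hr hπ h
    simp only [G, dif_pos h.2.le, dif_pos (Nat.succ_le_of_lt h.2), hg.vOpt_eq]
    rw [stateLaw_eq_stateLawAt] at h1 ⊢
    linarith
  have h2 : ∑ h : Fin H, (G h - G (h + 1)) = G 0 - G H := by
    rw [Fin.sum_univ_eq_sum_range (fun n => G n - G (n + 1)) H, Finset.sum_range_sub']
  rw [Finset.sum_congr rfl fun h _ => hstep h, Finset.sum_add_distrib, ← value_eq_sum s₁ hπ hr,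
    hG0, hGH] at h2
  linarith

/-- No policy beats the optimal value function. -/
theorem value_le_vOpt [Finite A] [Nonempty A] (hr : IsReward P r s₁) (hπ : IsPolicy π) :
    value P r s₁ π ≤ vOpt P r 0 s₁ := by
  let G : ℕ → ℝ := fun n => if hn : n ≤ H then ∫ s, vOpt P r n s ∂(stateLawAt P π s₁ n hn) else 0
  have hG0 : G 0 = vOpt P r 0 s₁ := by
    simp only [G, dif_pos (Nat.zero_le H), stateLawAt_zero]
    exact integral_dirac' _ _ (measurable_vOpt P hr (Nat.zero_le H)).stronglyMeasurable
  have hGH : G H = 0 := by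
    simp [G, vOpt_self]
  have hstep : ∀ h : Fin H, ∫ s, r h s (π h s) ∂(stateLaw P π s₁ h) ≤ G h - G (h + 1) := fun h => by
    have := isProbabilityMeasure_stateLawAt P s₁ hπ h h.2.le
    have h1 := integral_qOpt_eq (Q := P) hr hπ h
    rw [modelGap_self] at h1
    have h2 : ∫ s, qOpt P r h s (π h s) ∂(stateLawAt P π s₁ h h.2.le)
        ≤ ∫ s, vOpt P r h s ∂(stateLawAt P π s₁ h h.2.le) :=
      integral_mono
        (integrable_of_abs_le _ (measurable_qOpt_policy hr hπ h) fun s => abs_qOpt_le hr h s _)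
        (integrable_of_abs_le _ (measurable_vOpt P hr h.2.le) (abs_vOpt_le P hr h.2.le))
        fun s => qOpt_le_vOpt _ _ _ _ _
    simp only [G, dif_pos h.2.le, dif_pos (Nat.succ_le_of_lt h.2)]
    rw [stateLaw_eq_stateLawAt] at h1 ⊢
    linarith
  calc value P r s₁ π = ∑ h : Fin H, ∫ s, r h s (π h s) ∂(stateLaw P π s₁ h) :=
        value_eq_sum s₁ hπ hr
    _ ≤ ∑ h : Fin H, (G h - G (h + 1)) := Finset.sum_le_sum fun h _ => hstep h
    _ = vOpt P r 0 s₁ := by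
        rw [Fin.sum_univ_eq_sum_range (fun n => G n - G (n + 1)) H, Finset.sum_range_sub', hG0,
          hGH, sub_zero]

end Optimal

/-! ### The data of OPERA and its confidence regions -/

section Data

variable {S : Type u} {A : Type v} {ι : Type w} {H : ℕ}

/-- The model chosen by OPERA in iteration `i`, as a function of the data. -/
def chosen (sel : (t : ℕ) → (Fin t → Batch S A H) → ι) {T : ℕ} (D : Fin T → Batch S A H)
    (i : Fin T) : ι :=
  sel i fun j : Fin i => D (j.castLE i.2.le)

theorem chosen_snoc_castSucc (sel : (t : ℕ) → (Fin t → Batch S A H) → ι) {T : ℕ}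
    (D : Fin T → Batch S A H) (b : Batch S A H) (i : Fin T) :
    chosen sel (Fin.snoc D b : Fin (T + 1) → Batch S A H) i.castSucc = chosen sel D i := by
  have h : ∀ j : Fin i, (Fin.snoc D b : Fin (T + 1) → Batch S A H)
      (j.castLE i.castSucc.2.le) = D (j.castLE i.2.le) := fun j =>
    Fin.snoc_castSucc (α := fun _ => Batch S A H) b D (j.castLE i.2.le)
  exact congrArg (sel i) (funext h)

theorem chosen_snoc_last (sel : (t : ℕ) → (Fin t → Batch S A H) → ι) {T : ℕ}
    (D : Fin T → Batch S A H) (b : Batch S A H) :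
    chosen sel (Fin.snoc D b : Fin (T + 1) → Batch S A H) (Fin.last T) = sel T D := by
  have h : ∀ j : Fin T, (Fin.snoc D b : Fin (T + 1) → Batch S A H)
      (j.castLE (Fin.last T).2.le) = D j := fun j =>
    Fin.snoc_castSucc (α := fun _ => Batch S A H) b D j
  exact congrArg (sel T) (funext h)

variable [MeasurableSpace S] [MeasurableSpace A]

theorem measurable_chosen [Finite ι] [MeasurableSpace ι]
    {sel : (t : ℕ) → (Fin t → Batch S A H) → ι}
    (hsel : ∀ t f, MeasurableSet (sel t ⁻¹' {f})) {T : ℕ} (i : Fin T) :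
    Measurable fun D : Fin T → Batch S A H => chosen sel D i :=
  (measurable_to_countable' (hsel i)).comp (by fun_prop)

theorem measurable_prod_chosen [Finite ι]
    {sel : (t : ℕ) → (Fin t → Batch S A H) → ι} (hsel : ∀ t f, MeasurableSet (sel t ⁻¹' {f}))
    {G : ι → Batch S A H → ENNReal} (hG : ∀ f, Measurable (G f)) (T : ℕ) :
    Measurable fun D : Fin T → Batch S A H => ∏ i, G (chosen sel D i) (D i) := by
  let _ : MeasurableSpace ι := ⊤
  have hG' : Measurable fun x : ι × Batch S A H => G x.1 x.2 :=
    measurable_from_prod_countable_right hG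
  exact Finset.measurable_prod _ fun i _ =>
    hG'.comp ((measurable_chosen hsel i).prodMk (measurable_pi_apply i))

variable [Fintype A] [Nonempty A] (P : Transition S A H) (s₁ : S)

/-- The law of `(s_h, a_h)` when `s_h` is reached by running `π` and `a_h` is uniform. -/
noncomputable def actionLaw (π : Policy S A H) (h : Fin H) : Measure (S × A) :=
  (stateLaw P π s₁ h).prod (PMF.uniformOfFintype A).toMeasure

/-- The law of the data of one iteration. -/
noncomputable def batchLaw (π : Policy S A H) : Measure (Batch S A H) :=
  Measure.pi fun h => tupleLaw P s₁ π h

/-- The kernel that draws the data of one iteration, given the past data. -/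
noncomputable def batchKernel [Finite ι] (π : ι → Policy S A H)
    {sel : (t : ℕ) → (Fin t → Batch S A H) → ι}
    (hsel : ∀ t f, MeasurableSet (sel t ⁻¹' {f})) (t : ℕ) :
    Kernel (Fin t → Batch S A H) (Batch S A H) where
  toFun D := batchLaw P s₁ (π (sel t D))
  measurable' := by
    let _ : MeasurableSpace ι := ⊤
    exact (measurable_from_top (f := fun f : ι => batchLaw P s₁ (π f))).comp
      (measurable_to_countable' (hsel t))

theorem operaLaw_succ [Finite ι] (π : ι → Policy S A H)
    {sel : (t : ℕ) → (Fin t → Batch S A H) → ι}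
    (hsel : ∀ t f, MeasurableSet (sel t ⁻¹' {f})) (t : ℕ) :
    operaLaw P s₁ π sel (t + 1) = (operaLaw P s₁ π sel t).bind fun D =>
      (batchKernel P s₁ π hsel t D).map
        fun b => (Fin.snoc D b : Fin (t + 1) → Batch S A H) := rfl

variable [∀ h, IsMarkovKernel (P h)]

theorem isProbabilityMeasure_actionLaw {π : Policy S A H} (hπ : IsPolicy π) (h : Fin H) :
    IsProbabilityMeasure (actionLaw P s₁ π h) := by
  have : IsProbabilityMeasure (stateLaw P π s₁ h) :=
    isProbabilityMeasure_stateLawAt P s₁ hπ h h.2.le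
  unfold actionLaw
  infer_instance

theorem isProbabilityMeasure_tupleLaw {π : Policy S A H} (hπ : IsPolicy π) (h : Fin H) :
    IsProbabilityMeasure (tupleLaw P s₁ π h) := by
  have := isProbabilityMeasure_actionLaw P s₁ hπ h
  change IsProbabilityMeasure (actionLaw P s₁ π h ⊗ₘ P h)
  infer_instance

theorem isProbabilityMeasure_batchLaw {π : Policy S A H} (hπ : IsPolicy π) :
    IsProbabilityMeasure (batchLaw P s₁ π) := by
  have := isProbabilityMeasure_tupleLaw P s₁ hπ
  unfold batchLaw
  infer_instance

variable {P s₁} [Finite ι] {π : ι → Policy S A H}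
  {sel : (t : ℕ) → (Fin t → Batch S A H) → ι}

theorem isMarkovKernel_batchKernel (hπ : ∀ f, IsPolicy (π f))
    (hsel : ∀ t f, MeasurableSet (sel t ⁻¹' {f})) (t : ℕ) :
    IsMarkovKernel (batchKernel P s₁ π hsel t) :=
  ⟨fun D => isProbabilityMeasure_batchLaw P s₁ (hπ (sel t D))⟩

theorem isProbabilityMeasure_operaLaw (hπ : ∀ f, IsPolicy (π f))
    (hsel : ∀ t f, MeasurableSet (sel t ⁻¹' {f})) (T : ℕ) :
    IsProbabilityMeasure (operaLaw P s₁ π sel T) := by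
  induction T with
  | zero => rw [operaLaw]; infer_instance
  | succ t ih =>
    have := isMarkovKernel_batchKernel (P := P) (s₁ := s₁) hπ hsel t
    rw [operaLaw_succ P s₁ π hsel]
    exact isProbabilityMeasure_bind_map_snoc _ _

/-- Tail bounds for the first `n` iterations thereby transfer to the law of all `T` iterations,
where the union bound takes place. -/
theorem map_castLE_operaLaw (hπ : ∀ f, IsPolicy (π f))
    (hsel : ∀ t f, MeasurableSet (sel t ⁻¹' {f})) {n T : ℕ} (hn : n ≤ T) :
    (operaLaw P s₁ π sel T).map (fun D (i : Fin n) => D (i.castLE hn))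
      = operaLaw P s₁ π sel n := by
  induction T, hn using Nat.le_induction with
  | base => exact Measure.map_id
  | succ T hn ih =>
    have := isMarkovKernel_batchKernel (P := P) (s₁ := s₁) hπ hsel T
    rw [← map_init_bind_map_snoc (operaLaw P s₁ π sel T) (batchKernel P s₁ π hsel T),
      Measure.map_map (by fun_prop) (by fun_prop), ← operaLaw_succ P s₁ π hsel] at ih
    exact ih

/-- A product of factors with conditional means at most one has mean at most one. -/
theorem lintegral_prod_chosen_le_one (hπ : ∀ f, IsPolicy (π f))
    (hsel : ∀ t f, MeasurableSet (sel t ⁻¹' {f}))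
    {G : ι → Batch S A H → ENNReal} (hG : ∀ f, Measurable (G f))
    (h1 : ∀ f, ∫⁻ b, G f b ∂(batchLaw P s₁ (π f)) ≤ 1) (T : ℕ) :
    ∫⁻ D, ∏ i, G (chosen sel D i) (D i) ∂(operaLaw P s₁ π sel T) ≤ 1 := by
  induction T with
  | zero =>
    have := isProbabilityMeasure_operaLaw (P := P) (s₁ := s₁) hπ hsel 0
    simp
  | succ t ih =>
    have := isMarkovKernel_batchKernel (P := P) (s₁ := s₁) hπ hsel t
    rw [operaLaw_succ P s₁ π hsel, lintegral_bind_map_snoc _ _ (measurable_prod_chosen hsel hG _)]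
    refine le_trans (lintegral_mono fun D => ?_) ih
    simp only [Fin.prod_univ_castSucc, chosen_snoc_castSucc, chosen_snoc_last, Fin.snoc_castSucc,
      Fin.snoc_last]
    rw [lintegral_const_mul _ (hG _)]
    exact mul_le_of_le_one_right' (h1 (sel t D))

/-- The mean squared error of the model `Q` on the discriminator `φ` under the roll-in `π`. -/
noncomputable def meanSqErr (P Q : Transition S A H) (s₁ : S) (π : Policy S A H) (h : Fin H)
    (φ : S → A → S → ℝ) : ℝ :=
  ∫ x, ((∫ s', φ x.1 x.2 s' ∂(Q h x)) - ∫ s', φ x.1 x.2 s' ∂(P h x)) ^ 2 ∂(actionLaw P s₁ π h)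

/-- The amount by which past data underestimate the errors of the model `Q`. -/
noncomputable def deviation (P Q : Transition S A H) (s₁ : S) (B : ℝ) (π : ι → Policy S A H)
    (sel : (t : ℕ) → (Fin t → Batch S A H) → ι) {t : ℕ} (D : Fin t → Batch S A H) (h : Fin H)
    (φ : S → A → S → ℝ) : ℝ :=
  (∑ i, meanSqErr P Q s₁ (π (chosen sel D i)) h φ) / (16 * B ^ 2)
    - (witnessLoss Q D h φ - witnessLoss P D h φ) / (4 * B ^ 2)

/-- The exponential of the deviation is a product over iterations of factors with conditional mean
at most `1`, so its mean is at most `1` and Markov's inequality applies. -/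
theorem operaLaw_deviation_le (hπ : ∀ f, IsPolicy (π f))
    (hsel : ∀ t f, MeasurableSet (sel t ⁻¹' {f})) {Q : Transition S A H}
    [∀ h, IsMarkovKernel (Q h)] {B : ℝ} (hB : 0 < B) {h : Fin H} {φ : S → A → S → ℝ}
    (hφ : Measurable fun x : (S × A) × S => φ x.1.1 x.1.2 x.2) (hφB : ∀ s a s', |φ s a s'| ≤ B)
    (t : ℕ) (x : ℝ) :
    operaLaw P s₁ π sel t {D | x < deviation P Q s₁ B π sel D h φ}
      ≤ ENNReal.ofReal (Real.exp (-x)) := by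
  let g : ι → Batch S A H → ℝ := fun f b => meanSqErr P Q s₁ (π f) h φ / (16 * B ^ 2)
    - (((∫ s', φ (b h).1.1 (b h).1.2 s' ∂(Q h (b h).1)) - φ (b h).1.1 (b h).1.2 (b h).2) ^ 2
      - ((∫ s', φ (b h).1.1 (b h).1.2 s' ∂(P h (b h).1)) - φ (b h).1.1 (b h).1.2 (b h).2) ^ 2)
      / (4 * B ^ 2)
  let G : ι → Batch S A H → ENNReal := fun f b => ENNReal.ofReal (Real.exp (g f b))
  have hgen : ∀ p q : S × A → ℝ, Measurable p → Measurable q → ∀ m : ℝ,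
      Measurable fun y : (S × A) × S => ENNReal.ofReal (Real.exp (m / (16 * B ^ 2)
        - ((q y.1 - φ y.1.1 y.1.2 y.2) ^ 2 - (p y.1 - φ y.1.1 y.1.2 y.2) ^ 2) / (4 * B ^ 2))) := by
    intro p q hp hq m
    have hp' : Measurable fun y : (S × A) × S => p y.1 := hp.comp measurable_fst
    have hq' : Measurable fun y : (S × A) × S => q y.1 := hq.comp measurable_fst
    exact ENNReal.measurable_ofReal.comp (Real.measurable_exp.comp (measurable_const.sub
      ((((hq'.sub hφ).pow_const 2).sub ((hp'.sub hφ).pow_const 2)).div_const _)))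
  have hmeas := hgen _ _ (measurable_integral_kernel (P h) hφ) (measurable_integral_kernel (Q h) hφ)
  have hG : ∀ f, Measurable (G f) := fun f =>
    (hmeas (meanSqErr P Q s₁ (π f) h φ)).comp (measurable_pi_apply h)
  have h1 : ∀ f, ∫⁻ b, G f b ∂(batchLaw P s₁ (π f)) ≤ 1 := fun f => by
    have := isProbabilityMeasure_tupleLaw P s₁ (hπ f)
    have := isProbabilityMeasure_actionLaw P s₁ (hπ f) h
    -- The factor sees only coordinate `h` of the batch, so the product law reduces to a single
    -- tuple law.
    have h2 := (measurePreserving_eval (fun h => tupleLaw P s₁ (π f) h) h).lintegral_comp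
      (hmeas (meanSqErr P Q s₁ (π f) h φ))
    have h3 := lintegral_exp_excess_loss_le (actionLaw P s₁ (π f) h) (P h) (Q h) hB hφ
      fun x => hφB _ _ _
    exact h2.trans_le h3
  have hprod : ∀ D : Fin t → Batch S A H, ∏ i, G (chosen sel D i) (D i)
      = ENNReal.ofReal (Real.exp (deviation P Q s₁ B π sel D h φ)) := fun D => by
    rw [← ENNReal.ofReal_prod_of_nonneg fun i _ => (Real.exp_pos _).le, ← Real.exp_sum]
    congr 2
    simp only [deviation, witnessLoss, Finset.sum_sub_distrib, ← Finset.sum_div, g]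
  have h4 := lintegral_prod_chosen_le_one (P := P) (s₁ := s₁) hπ hsel hG h1 t
  have h5 := mul_meas_ge_le_lintegral (μ := operaLaw P s₁ π sel t)
    (measurable_prod_chosen hsel hG t) (ENNReal.ofReal (Real.exp x))
  have h6 : ENNReal.ofReal (Real.exp x) * operaLaw P s₁ π sel t
      {D | x < deviation P Q s₁ B π sel D h φ} ≤ 1 := by
    refine le_trans ?_ (h5.trans h4)
    refine mul_le_mul_right (measure_mono fun D (hD : x < _) => ?_) _
    rw [Set.mem_ofPred_eq, hprod]
    exact ENNReal.ofReal_le_ofReal (Real.exp_le_exp.2 hD.le)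
  rw [Real.exp_neg, ENNReal.ofReal_inv_of_pos (Real.exp_pos x)]
  exact ENNReal.le_inv_iff_mul_le.2 (by rwa [mul_comm])

/-- The event that no deviation ever exceeds `x`. -/
def goodEvent (P : Transition S A H) (s₁ : S) (B : ℝ) (M : ι → Transition S A H)
    (π : ι → Policy S A H) (V : Fin H → Finset (S → A → S → ℝ))
    (sel : (t : ℕ) → (Fin t → Batch S A H) → ι) (x : ℝ) (T : ℕ) : Set (Fin T → Batch S A H) :=
  {D | ∀ t : Fin T, ∀ h, ∀ φ ∈ V h, ∀ f,
    deviation P (M f) s₁ B π sel (fun i : Fin t => D (i.castLE t.2.le)) h φ ≤ x}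

/-- A union bound over iterations, steps, discriminators and models, each contributing the tail `exp
(-x)`. -/
theorem operaLaw_compl_goodEvent_le {ι : Type w} [Fintype ι] {π : ι → Policy S A H}
    {sel : (t : ℕ) → (Fin t → Batch S A H) → ι} (hπ : ∀ f, IsPolicy (π f))
    (hsel : ∀ t f, MeasurableSet (sel t ⁻¹' {f})) {M : ι → Transition S A H}
    [∀ f h, IsMarkovKernel (M f h)] {B : ℝ} (hB : 0 < B) {V : Fin H → Finset (S → A → S → ℝ)}
    (hV : IsDiscriminatorClass V B) (x : ℝ) (T : ℕ) :
    operaLaw P s₁ π sel T (goodEvent P s₁ B M π V sel x T)ᶜ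
      ≤ ENNReal.ofReal (T * H * Fintype.card ι * discCard V * Real.exp (-x)) := by
  have hsub : (goodEvent P s₁ B M π V sel x T)ᶜ ⊆ ⋃ t : Fin T, ⋃ h : Fin H, ⋃ φ ∈ V h, ⋃ f : ι,
      (fun (D : Fin T → Batch S A H) (i : Fin t) => D (i.castLE t.2.le)) ⁻¹'
        {D | x < deviation P (M f) s₁ B π sel D h φ} := by
    intro D hD
    simp only [goodEvent, Set.mem_compl_iff, Set.mem_ofPred_eq, not_forall, not_le] at hD
    obtain ⟨t, h, φ, hφ, f, hf⟩ := hD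
    simp only [Set.mem_iUnion]
    exact ⟨t, h, φ, hφ, f, hf⟩
  have hone : ∀ (t : Fin T) (h : Fin H), ∀ φ ∈ V h, ∀ f : ι, operaLaw P s₁ π sel T
      ((fun (D : Fin T → Batch S A H) (i : Fin t) => D (i.castLE t.2.le)) ⁻¹'
        {D | x < deviation P (M f) s₁ B π sel D h φ}) ≤ ENNReal.ofReal (Real.exp (-x)) := by
    intro t h φ hφ f
    refine le_trans ?_ (operaLaw_deviation_le (P := P) (s₁ := s₁) (Q := M f) (h := h) hπ hsel hB
      (hV.measurable h φ hφ) (hV.bounded h φ hφ) t x)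
    rw [← map_castLE_operaLaw hπ hsel t.2.le]
    exact Measure.le_map_apply
      (measurable_pi_lambda _ fun i => measurable_pi_apply _).aemeasurable _
  refine (measure_mono hsub).trans ?_
  calc _ ≤ ∑ t : Fin T, ∑ h : Fin H, ∑ φ ∈ V h, ∑ f : ι, ENNReal.ofReal (Real.exp (-x)) := by
        refine (measure_iUnion_fintype_le _ _).trans (Finset.sum_le_sum fun t _ => ?_)
        refine (measure_iUnion_fintype_le _ _).trans (Finset.sum_le_sum fun h _ => ?_)
        refine (measure_biUnion_finset_le _ _).trans (Finset.sum_le_sum fun φ hφ => ?_)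
        exact (measure_iUnion_fintype_le _ _).trans (Finset.sum_le_sum fun f _ => hone t h φ hφ f)
    _ ≤ ∑ t : Fin T, ∑ h : Fin H,
          (discCard V * (Fintype.card ι * ENNReal.ofReal (Real.exp (-x)))) := by
        refine Finset.sum_le_sum fun t _ => Finset.sum_le_sum fun h _ => ?_
        simp only [Finset.sum_const, Finset.card_univ, nsmul_eq_mul]
        gcongr
        exact Finset.le_sup (f := fun h => (V h).card) (Finset.mem_univ h)
    _ = _ := by
        simp only [Finset.sum_const, Finset.card_univ, Fintype.card_fin, nsmul_eq_mul]
        rw [ENNReal.ofReal_mul (by positivity), ENNReal.ofReal_mul (by positivity),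
          ENNReal.ofReal_mul (by positivity), ENNReal.ofReal_mul (by positivity)]
        simp only [ENNReal.ofReal_natCast]
        ring

end Data

/-! ### The regret on the good event -/

section Regret

theorem sq_integral_le_integral_sq {Z : Type*} [MeasurableSpace Z] (ν : Measure Z)
    [IsProbabilityMeasure ν] {f : Z → ℝ} (hf : Integrable f ν)
    (hf2 : Integrable (fun z => f z ^ 2) ν) : (∫ z, f z ∂ν) ^ 2 ≤ ∫ z, f z ^ 2 ∂ν := by
  set c := ∫ z, f z ∂ν with hc
  have h1 : ∫ z, (f z ^ 2 - (2 * c * f z - c ^ 2)) ∂ν = (∫ z, f z ^ 2 ∂ν) - c ^ 2 := by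
    have hi : Integrable (fun z => 2 * c * f z - c ^ 2) ν :=
      (hf.const_mul _).sub (integrable_const _)
    rw [integral_sub hf2 hi,
      integral_sub (hf.const_mul _) (integrable_const _), integral_const_mul, ← hc]
    simp only [integral_const, probReal_univ, smul_eq_mul, one_mul]
    ring
  have h2 : 0 ≤ ∫ z, (f z ^ 2 - (2 * c * f z - c ^ 2)) ∂ν :=
    integral_nonneg fun z => by
      change 0 ≤ f z ^ 2 - (2 * c * f z - c ^ 2)
      nlinarith [sq_nonneg (f z - c)]
  linarith

variable {S : Type u} {A : Type v} {ι : Type w} {H : ℕ} [MeasurableSpace S] [MeasurableSpace A]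

/-- The difference of the predictions of `φ` by the models `Q` and `P`. -/
noncomputable def discrepancy (P Q : Transition S A H) (h : Fin H) (φ : S → A → S → ℝ)
    (x : S × A) : ℝ :=
  (∫ s', φ x.1 x.2 s' ∂(Q h x)) - ∫ s', φ x.1 x.2 s' ∂(P h x)

theorem modelGap_eq_integral_discrepancy (P Q : Transition S A H) (s₁ : S) (πf πg : Policy S A H)
    (h : Fin H) (φ : S → A → S → ℝ) :
    modelGap P Q s₁ πf πg h φ = ∫ s, discrepancy P Q h φ (s, πg h s) ∂(stateLaw P πf s₁ h) := rfl

theorem meanSqErr_nonneg [Fintype A] [Nonempty A] (P Q : Transition S A H) (s₁ : S) (π : Policy S A H) (h : Fin H)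
    (φ : S → A → S → ℝ) : 0 ≤ meanSqErr P Q s₁ π h φ :=
  integral_nonneg fun _ => sq_nonneg _

/-- On the good event the true model is in the confidence region, and all models in the confidence
region have small errors. -/
theorem confSet_of_deviation_le [Fintype A] [Nonempty A] [Finite ι] {P : Transition S A H}
    {M : ι → Transition S A H}
    {π : ι → Policy S A H} {V : Fin H → Finset (S → A → S → ℝ)} {B β : ℝ} (hB : 0 < B)
    {s₁ : S} {sel : (t : ℕ) → (Fin t → Batch S A H) → ι} {t : ℕ} {D : Fin t → Batch S A H}
    {k : ι} (hk : M k = P)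
    (hD : ∀ h, ∀ φ ∈ V h, ∀ f, deviation P (M f) s₁ B π sel D h φ ≤ β / (4 * B ^ 2)) :
    k ∈ confSet M V β D ∧ ∀ f ∈ confSet M V β D, ∀ h, ∀ φ ∈ V h,
      ∑ i, meanSqErr P (M f) s₁ (π (chosen sel D i)) h φ ≤ 8 * β := by
  have : Nonempty ι := ⟨k⟩
  have hB2 : 0 < 4 * B ^ 2 := by positivity
  have hdev : ∀ h, ∀ φ ∈ V h, ∀ f,
      (∑ i, meanSqErr P (M f) s₁ (π (chosen sel D i)) h φ) / 4
        ≤ β + (witnessLoss (M f) D h φ - witnessLoss P D h φ) := by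
    intro h φ hφ f
    have h1 := hD h φ hφ f
    rw [deviation, show 16 * B ^ 2 = 4 * (4 * B ^ 2) by ring, ← div_div, ← sub_div,
      div_le_div_iff_of_pos_right hB2] at h1
    linarith
  refine ⟨fun h φ hφ => ?_, fun f hf h φ hφ => ?_⟩
  -- The empirical minimizer `g` cannot beat the true model by more than `β`, because its mean
  -- squared errors are nonnegative.
  · obtain ⟨g, hg⟩ := exists_eq_ciInf_of_finite (f := fun g => witnessLoss (M g) D h φ)
    have h1 := hdev h φ hφ g
    have h2 : 0 ≤ ∑ i, meanSqErr P (M g) s₁ (π (chosen sel D i)) h φ :=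
      Finset.sum_nonneg fun i _ => meanSqErr_nonneg _ _ _ _ _ _
    rw [← hg, hk]
    linarith
  · have h1 := hdev h φ hφ f
    have h2 := hf h φ hφ
    have h3 : ⨅ g, witnessLoss (M g) D h φ ≤ witnessLoss P D h φ :=
      (ciInf_le (Finite.bddBelow_range _) k).trans_eq (by rw [hk])
    linarith

variable (P Q : Transition S A H) [∀ h, IsMarkovKernel (P h)] [∀ h, IsMarkovKernel (Q h)]

theorem measurable_discrepancy {h : Fin H} {φ : S → A → S → ℝ}
    (hφ : Measurable fun x : (S × A) × S => φ x.1.1 x.1.2 x.2) :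
    Measurable (discrepancy P Q h φ) :=
  (measurable_integral_kernel (Q h) hφ).sub (measurable_integral_kernel (P h) hφ)

theorem abs_discrepancy_le {h : Fin H} {φ : S → A → S → ℝ} {B : ℝ}
    (hφB : ∀ s a s', |φ s a s'| ≤ B) (x : S × A) : |discrepancy P Q h φ x| ≤ 2 * B := by
  have h1 := abs_le.1 (abs_integral_le_of_abs_le (Q h x) (hφB x.1 x.2))
  have h2 := abs_le.1 (abs_integral_le_of_abs_le (P h x) (hφB x.1 x.2))
  rw [discrepancy, abs_le]
  constructor <;> linarith

theorem abs_modelGap_le {s₁ : S} {πf : Policy S A H} (hf : IsPolicy πf) (πg : Policy S A H)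
    {h : Fin H} {φ : S → A → S → ℝ} {B : ℝ} (hφB : ∀ s a s', |φ s a s'| ≤ B) :
    |modelGap P Q s₁ πf πg h φ| ≤ 2 * B := by
  have : IsProbabilityMeasure (stateLaw P πf s₁ h) :=
    isProbabilityMeasure_stateLawAt P s₁ hf h h.2.le
  exact abs_integral_le_of_abs_le _ fun s => abs_discrepancy_le P Q hφB _

/-- By completeness and symmetry, one discriminator attains the largest discrepancy everywhere. -/
theorem IsDiscriminatorClass.exists_forall_abs_discrepancy_le
    {V : Fin H → Finset (S → A → S → ℝ)} {B : ℝ} (hV : IsDiscriminatorClass V B) (h : Fin H)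
    (P Q : Transition S A H) :
    ∃ φ ∈ V h, ∀ ψ ∈ V h, ∀ x, |discrepancy P Q h ψ x| ≤ discrepancy P Q h φ x := by
  choose w hw hmax using fun (s : S) (a : A) =>
    Finset.exists_max_image (V h) (fun φ => discrepancy P Q h φ (s, a)) (hV.nonempty h)
  refine ⟨_, hV.complete h w hw, fun ψ hψ x => ?_⟩
  have h1 := hmax x.1 x.2 ψ hψ
  have h2 := hmax x.1 x.2 (-ψ) (hV.symmetric h ψ hψ)
  have h3 : discrepancy P Q h (-ψ) x = - discrepancy P Q h ψ x := by
    simp only [discrepancy, Pi.neg_apply, integral_neg]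
    ring
  rw [Prod.mk.eta, h3] at h2
  exact abs_le.2 ⟨neg_le.1 h2, h1⟩

/-- Jensen's inequality moves the square inside. The action of `πg` then has probability `1 / |A|`
under uniform exploration, so its term is at most `|A|` times the average over actions. -/
theorem sq_modelGap_le_card_mul_meanSqErr [Fintype A] [Nonempty A] [MeasurableSingletonClass A]
    {s₁ : S} {πf πg : Policy S A H} (hf : IsPolicy πf) (hg : IsPolicy πg)
    {h : Fin H} {φ : S → A → S → ℝ} {B : ℝ}
    (hφ : Measurable fun x : (S × A) × S => φ x.1.1 x.1.2 x.2) (hφB : ∀ s a s', |φ s a s'| ≤ B) :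
    modelGap P Q s₁ πf πg h φ ^ 2 ≤ Fintype.card A * meanSqErr P Q s₁ πf h φ := by
  have : IsProbabilityMeasure (stateLaw P πf s₁ h) :=
    isProbabilityMeasure_stateLawAt P s₁ hf h h.2.le
  have hm := measurable_discrepancy P Q (h := h) hφ
  have hb := abs_discrepancy_le P Q (h := h) hφB
  have hb2 : ∀ x, |discrepancy P Q h φ x ^ 2| ≤ (2 * B) ^ 2 := fun x => by
    rw [abs_pow]; exact pow_le_pow_left₀ (abs_nonneg _) (hb x) 2
  have hmg : Measurable fun s => discrepancy P Q h φ (s, πg h s) :=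
    hm.comp (measurable_id.prodMk (hg h))
  have hma : ∀ a : A, Measurable fun s => discrepancy P Q h φ (s, a) ^ 2 := fun a =>
    (hm.comp (measurable_id.prodMk measurable_const)).pow_const 2
  have h1 : meanSqErr P Q s₁ πf h φ = ∫ s, (Fintype.card A : ℝ)⁻¹ *
      ∑ a : A, discrepancy P Q h φ (s, a) ^ 2 ∂(stateLaw P πf s₁ h) := by
    change ∫ x, discrepancy P Q h φ x ^ 2 ∂(actionLaw P s₁ πf h) = _
    rw [actionLaw, integral_prod _ (integrable_of_abs_le _ (hm.pow_const 2) hb2)]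
    refine integral_congr_ae (.of_forall fun s => ?_)
    simp only [PMF.integral_eq_sum, PMF.uniformOfFintype_apply, smul_eq_mul, Finset.mul_sum]
    simp
  have hi : Integrable (fun s => ∑ a : A, discrepancy P Q h φ (s, a) ^ 2)
      (stateLaw P πf s₁ h) :=
    integrable_finsetSum _ fun a _ => integrable_of_abs_le _ (hma a) fun s => hb2 _
  rw [h1, integral_const_mul, ← mul_assoc, mul_inv_cancel₀ (by positivity), one_mul,
    modelGap_eq_integral_discrepancy]
  refine (sq_integral_le_integral_sq _ (integrable_of_abs_le _ hmg fun s => hb _)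
    (integrable_of_abs_le _ (hmg.pow_const 2) fun s => hb2 _)).trans ?_
  refine integral_mono (integrable_of_abs_le _ (hmg.pow_const 2) fun s => hb2 _) hi fun s => ?_
  exact Finset.single_le_sum (f := fun a => discrepancy P Q h φ (s, a) ^ 2)
    (fun a _ => sq_nonneg _) (Finset.mem_univ (πg h s))

theorem modelGap_le_modelGap {s₁ : S} {πf πg : Policy S A H} (hf : IsPolicy πf) (hg : IsPolicy πg)
    {V : Fin H → Finset (S → A → S → ℝ)} {B : ℝ} (hV : IsDiscriminatorClass V B) {h : Fin H}
    {φ ψ : S → A → S → ℝ} (hφ : φ ∈ V h) (hψ : ψ ∈ V h)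
    (hle : ∀ x, |discrepancy P Q h ψ x| ≤ discrepancy P Q h φ x) :
    modelGap P Q s₁ πf πg h ψ ≤ modelGap P Q s₁ πf πg h φ := by
  have : IsProbabilityMeasure (stateLaw P πf s₁ h) :=
    isProbabilityMeasure_stateLawAt P s₁ hf h h.2.le
  have hi : ∀ χ ∈ V h, Integrable (fun s => discrepancy P Q h χ (s, πg h s))
      (stateLaw P πf s₁ h) := fun χ hχ =>
    integrable_of_abs_le _ ((measurable_discrepancy P Q (hV.measurable h χ hχ)).comp
      (measurable_id.prodMk (hg h))) fun s => abs_discrepancy_le P Q (hV.bounded h χ hχ) _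
  exact integral_mono (hi ψ hψ) (hi φ hφ) fun s => (le_abs_self _).trans (hle _)

variable {P} [Fintype A] [Nonempty A]

/-- The regret of OPERA on the good event. -/
theorem sum_regret_le [Finite ι] [NeZero H] [MeasurableSingletonClass A] {r : Reward S A H} {s₁ : S}
    (hr : IsReward P r s₁) {M : ι → Transition S A H} [∀ f h, IsMarkovKernel (M f h)]
    {k : ι} (hk : M k = P) {π : ι → Policy S A H} (hπ : ∀ f, IsPolicy (π f))
    (hg : ∀ f, IsGreedy (M f) r (π f)) {V : Fin H → Finset (S → A → S → ℝ)} {B : ℝ} (hB : 0 < B)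
    (hV : IsDiscriminatorClass V B) {κ : ℝ} (hκ : 0 < κ) {d : ℕ}
    (hd : HasWitnessEmbedding P r s₁ M π V κ d)
    {β : ℝ} (hβ : B ^ 2 ≤ 2 * β)
    {sel : (t : ℕ) → (Fin t → Batch S A H) → ι} (hsel : IsOperaRule r s₁ M π V β sel)
    {T : ℕ} {D : Fin T → Batch S A H} (hD : D ∈ goodEvent P s₁ B M π V sel (β / (4 * B ^ 2)) T)
    {x : ℝ} (hx : 0 ≤ x)
    (hTx : T * (32 * Fintype.card A * β * (d * Real.log (d + T * d ^ 2))) ≤ x ^ 2) :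
    ∑ t : Fin T, (vOpt P r 0 s₁ - value P r s₁ (π (chosen sel D t))) ≤ H * x / κ := by
  obtain ⟨W, X, hWX⟩ := hd
  set a : ℝ := (Fintype.card A : ℝ) with ha
  have ha1 : 1 ≤ a := by rw [ha]; exact_mod_cast Fintype.card_pos
  have hβ0 : 0 ≤ β := by nlinarith [sq_nonneg B]
  let D' : (t : Fin T) → Fin t → Batch S A H := fun t i => D (i.castLE t.2.le)
  have hconf : ∀ t : Fin T, k ∈ confSet M V β (D' t) ∧ ∀ f ∈ confSet M V β (D' t), ∀ h, ∀ φ ∈ V h,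
      ∑ i, meanSqErr P (M f) s₁ (π (chosen sel (D' t) i)) h φ ≤ 8 * β := fun t =>
    confSet_of_deviation_le hB hk (hD t)
  have hmem : ∀ t : Fin T, chosen sel D t ∈ confSet M V β (D' t) := fun t =>
    hsel.feasible t (D' t) ⟨k, (hconf t).1⟩
  have hopt : ∀ t : Fin T, vOpt P r 0 s₁ ≤ vOpt (M (chosen sel D t)) r 0 s₁ := fun t => by
    have h1 := hsel.maximal t (D' t) k (hconf t).1
    have h2 := (hg k).vOpt_eq 0 s₁
    have h3 := (hg (chosen sel D t)).vOpt_eq 0 s₁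
    rw [hk] at h1 h2
    simp only [Fin.val_zero] at h2 h3
    rw [h2, h3]
    exact h1
  let f : ℕ → ι := fun t => if ht : t < T then chosen sel D ⟨t, ht⟩ else k
  have hf : ∀ t : Fin T, f t = chosen sel D t := fun t => dif_pos t.2
  have hbound : ∀ h g e, |(inner ℝ (W h g) (X h e) : ℝ)| ≤ 2 * B := fun h g e => by
    obtain ⟨φ, hφ, hle⟩ := (hWX h e g).1
    exact hle.trans ((le_abs_self _).trans
      (abs_modelGap_le P (M g) (hπ e) (π g) (hV.bounded h φ hφ)))
  have hpast : ∀ h, ∀ t < T,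
      ∑ i ∈ Finset.range t, (inner ℝ (W h (f t)) (X h (f i)) : ℝ) ^ 2 ≤ 8 * a * β := by
    intro h t ht
    -- The confidence region controls the sum over `i` for one discriminator at a time, while the
    -- witness `ψ` below varies with `i`. The pointwise maximal `φ` depends on `f t` only and
    -- dominates them all.
    obtain ⟨φ, hφ, hmax⟩ := hV.exists_forall_abs_discrepancy_le h P (M (f t))
    rw [← Fin.sum_univ_eq_sum_range (fun i => (inner ℝ (W h (f t)) (X h (f i)) : ℝ) ^ 2) t]
    have h1 := (hconf ⟨t, ht⟩).2 _ (hmem ⟨t, ht⟩) h φ hφ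
    rw [← hf ⟨t, ht⟩] at h1
    have h2 : ∀ i : Fin t, (inner ℝ (W h (f t)) (X h (f i)) : ℝ) ^ 2
        ≤ a * meanSqErr P (M (f t)) s₁ (π (chosen sel (D' ⟨t, ht⟩) i)) h φ := by
      intro i
      have h3 : f i = chosen sel (D' ⟨t, ht⟩) i := hf (i.castLE ht.le)
      rw [← h3]
      obtain ⟨ψ, hψ, hle⟩ := (hWX h (f i) (f t)).1
      have h4 := hle.trans (modelGap_le_modelGap P (M (f t)) (hπ (f i)) (hπ (f t)) hV hφ hψ
        (hmax ψ hψ))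
      rw [← sq_abs]
      exact (pow_le_pow_left₀ (abs_nonneg _) h4 2).trans (sq_modelGap_le_card_mul_meanSqErr P
        (M (f t)) (hπ _) (hπ _) (hV.measurable h φ hφ) (hV.bounded h φ hφ))
    calc ∑ i : Fin t, (inner ℝ (W h (f t)) (X h (f i)) : ℝ) ^ 2
        ≤ ∑ i : Fin t, a * meanSqErr P (M (f t)) s₁ (π (chosen sel (D' ⟨t, ht⟩) i)) h φ :=
          Finset.sum_le_sum fun i _ => h2 i
      _ ≤ a * (8 * β) := by rw [← Finset.mul_sum]; gcongr
      _ = 8 * a * β := by ring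
  have hsum : ∀ h, ∑ t ∈ Finset.range T, (inner ℝ (W h (f t)) (X h (f t)) : ℝ) ≤ x := by
    intro h
    refine le_of_abs_le (abs_le_of_sq_le_sq ?_ hx)
    have h0 : ∑ t ∈ Finset.range T, (inner ℝ (W h (f t)) (X h (f t)) : ℝ) ^ 2
        ≤ 4 * (8 * a * β) * (d * Real.log (d + T * d ^ 2)) := by
      -- In dimension `0` the regularization `1 / d` makes no sense, but all inner products vanish.
      rcases Nat.eq_zero_or_pos d with rfl | hd0
      · have : ∀ t, (inner ℝ (W h (f t)) (X h (f t)) : ℝ) = 0 := fun t => by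
          rw [Subsingleton.elim (W h (f t)) 0, inner_zero_left]
        simp [this]
      · refine sum_inner_sq_le (W h) (X h) hd0 (hbound h) ?_ f (hpast h)
        nlinarith
    calc (∑ t ∈ Finset.range T, (inner ℝ (W h (f t)) (X h (f t)) : ℝ)) ^ 2
        ≤ T * ∑ t ∈ Finset.range T, (inner ℝ (W h (f t)) (X h (f t)) : ℝ) ^ 2 := by
          simpa using sq_sum_le_card_mul_sum_sq (s := Finset.range T)
            (f := fun t => (inner ℝ (W h (f t)) (X h (f t)) : ℝ))
      _ ≤ T * (4 * (8 * a * β) * (d * Real.log (d + T * d ^ 2))) := by gcongr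
      _ = T * (32 * a * β * (d * Real.log (d + T * d ^ 2))) := by ring
      _ ≤ x ^ 2 := hTx
  have hstep : ∀ t : Fin T, vOpt P r 0 s₁ - value P r s₁ (π (chosen sel D t))
      ≤ ∑ h, (inner ℝ (W h (f t)) (X h (f t)) : ℝ) / κ := by
    intro t
    have h1 := vOpt_sub_value_eq hr (hπ (chosen sel D t)) (hg (chosen sel D t))
    have h2 : ∀ h, modelGap P (M (chosen sel D t)) s₁ (π (chosen sel D t)) (π (chosen sel D t)) h
        (fun _ _ s' => vOpt (M (chosen sel D t)) r (h + 1) s')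
        ≤ (inner ℝ (W h (f t)) (X h (f t)) : ℝ) / κ := fun h => by
      rw [le_div_iff₀' hκ, hf]
      exact (hWX h _ _).2
    have h3 := Finset.sum_le_sum fun h (_ : h ∈ Finset.univ) => h2 h
    linarith [hopt t]
  calc ∑ t : Fin T, (vOpt P r 0 s₁ - value P r s₁ (π (chosen sel D t)))
      ≤ ∑ t : Fin T, ∑ h, (inner ℝ (W h (f t)) (X h (f t)) : ℝ) / κ :=
        Finset.sum_le_sum fun t _ => hstep t
    _ = ∑ h : Fin H, (∑ t ∈ Finset.range T, (inner ℝ (W h (f t)) (X h (f t)) : ℝ)) / κ := by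
        rw [Finset.sum_comm]
        refine Finset.sum_congr rfl fun h _ => ?_
        rw [Finset.sum_div,
          ← Fin.sum_univ_eq_sum_range (fun t => (inner ℝ (W h (f t)) (X h (f t)) : ℝ) / κ) T]
    _ ≤ ∑ _h : Fin H, x / κ := Finset.sum_le_sum fun h _ => by gcongr; exact hsum h
    _ = H * x / κ := by simp [mul_div_assoc]

end Regret

/-! ### The sample complexity -/

section SampleComplexity

variable {S : Type u} {A : Type v} {ι : Type w} {H : ℕ} [MeasurableSpace S] [MeasurableSpace A]

theorem isEpsOptimal_of_sum_regret_le [Finite A] [Nonempty A] {P : Transition S A H}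
    [∀ h, IsMarkovKernel (P h)]
    {r : Reward S A H} {s₁ : S} (hr : IsReward P r s₁) {π : ι → Policy S A H}
    {sel : (t : ℕ) → (Fin t → Batch S A H) → ι} {T : ℕ} (hT : 1 ≤ T) {D : Fin T → Batch S A H}
    {ε : ℝ} (h : ∑ t : Fin T, (vOpt P r 0 s₁ - value P r s₁ (π (chosen sel D t))) ≤ T * ε) :
    IsEpsOptimal P r s₁ ε (outputValue P r s₁ π sel D) := by
  intro π' hπ'
  have hT' : (0 : ℝ) < T := by exact_mod_cast hT
  have h1 := value_le_vOpt hr hπ'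
  have h2 : outputValue P r s₁ π sel D
      = (∑ t : Fin T, value P r s₁ (π (chosen sel D t))) / T := rfl
  rw [Finset.sum_sub_distrib] at h
  simp only [Finset.sum_const, Finset.card_univ, Fintype.card_fin, nsmul_eq_mul] at h
  have h3 : vOpt P r 0 s₁ - ε ≤ outputValue P r s₁ π sel D := by
    rw [h2, le_div_iff₀ hT']
    linarith
  linarith

theorem one_le_discCard [NeZero H] {V : Fin H → Finset (S → A → S → ℝ)} {B : ℝ}
    (hV : IsDiscriminatorClass V B) : 1 ≤ discCard V :=
  (Finset.card_pos.2 (hV.nonempty 0)).trans_le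
    (Finset.le_sup (f := fun h => (V h).card) (Finset.mem_univ (0 : Fin H)))

theorem log_dim_le {d T : ℕ} (hd : d ≤ T) (hT : 1 ≤ T) :
    Real.log (d + T * d ^ 2) ≤ 4 * Real.log (1 + T) := by
  rcases Nat.eq_zero_or_pos d with rfl | hd0
  · simpa using Real.log_nonneg (by linarith [T.cast_nonneg (α := ℝ)] : (1 : ℝ) ≤ 1 + T)
  have hd' : (d : ℝ) ≤ T := by exact_mod_cast hd
  have h0 : (0 : ℝ) < d := by exact_mod_cast hd0
  have hT0 : (1 : ℝ) ≤ T := by exact_mod_cast hT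
  have h1 : (d : ℝ) + T * d ^ 2 ≤ (1 + T) ^ 4 := by
    have h2 : (d : ℝ) ^ 2 ≤ T ^ 2 := pow_le_pow_left₀ h0.le hd' 2
    have h3 : (T : ℝ) * d ^ 2 ≤ T * T ^ 2 := by gcongr
    have h4 : (0 : ℝ) ≤ T ^ 4 := by positivity
    nlinarith [sq_nonneg (T : ℝ), pow_nonneg (zero_le_one.trans hT0) 3]
  have h2 := Real.log_le_log (by positivity) h1
  rw [Real.log_pow] at h2
  exact_mod_cast h2

/-- The deterministic estimate behind the number of iterations. -/
theorem iterations_bound {B : ℝ} (hB : 0 < B) {h a d T : ℕ} {β κ ε : ℝ} (hh : 1 ≤ h) (ha : 1 ≤ a)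
    (hT : 1 ≤ T) (hβ : 2 * B ^ 2 ≤ β) (hκ : 0 < κ) (hκ1 : κ ≤ 1) (hε : 0 < ε) (hε1 : ε ≤ 1)
    (hK : (2304 + 1 / B ^ 2) * complexity h a d β κ ε
      * Real.log (2 + complexity h a d β κ ε) ≤ T) :
    T * (32 * a * β * (d * Real.log (d + T * d ^ 2))) ≤ (T * (κ * ε / h)) ^ 2 := by
  set K := complexity h a d β κ ε with hKdef
  have hβ0 : 0 < β := lt_of_lt_of_le (by positivity) hβ
  have hh' : (1 : ℝ) ≤ h := by exact_mod_cast hh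
  have ha' : (1 : ℝ) ≤ a := by exact_mod_cast ha
  have hT' : (1 : ℝ) ≤ T := by exact_mod_cast hT
  have hK0 : 0 ≤ K := by rw [hKdef, complexity]; positivity
  have hκε : κ ^ 2 * ε ^ 2 ≤ 1 := by
    rw [← mul_pow]; exact pow_le_one₀ (by positivity) (mul_le_one₀ hκ1 hε.le hε1)
  have hdβ : d * β ≤ K := by
    rw [hKdef, complexity, le_div_iff₀ (by positivity)]
    have h1 : (1 : ℝ) ≤ h ^ 2 * a := one_le_mul_of_one_le_of_one_le (one_le_pow₀ hh') ha'
    calc (d : ℝ) * β * (κ ^ 2 * ε ^ 2) ≤ d * β * 1 := by gcongr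
      _ ≤ d * β * (h ^ 2 * a) := by gcongr
      _ = _ := by ring
  have hlog2 : 1 / 2 ≤ Real.log (2 + K) := by
    have h1 := Real.log_le_log (by norm_num) (show (2 : ℝ) ≤ 2 + K by linarith)
    linarith [Real.log_two_gt_d9]
  have hsplit : 2304 * K * Real.log (2 + K) + 1 / B ^ 2 * K * Real.log (2 + K) ≤ T := by
    linarith
  -- This is the purpose of the summand `1 / B ^ 2` in the constant: together with `2 * B ^ 2 ≤ β`
  -- it forces `d ≤ T`, so the logarithm of the potential depends on `T` alone.
  have hdT : (d : ℝ) ≤ T := by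
    have h1 : d * (2 * B ^ 2) ≤ K := (mul_le_mul_of_nonneg_left hβ d.cast_nonneg).trans hdβ
    have h2 : 0 ≤ 2304 * K * Real.log (2 + K) := by positivity
    calc (d : ℝ) = 1 / B ^ 2 * (d * (2 * B ^ 2)) * (1 / 2) := by field_simp
      _ ≤ 1 / B ^ 2 * K * Real.log (2 + K) := by gcongr
      _ ≤ T := by linarith
  have h1 : 2304 * K * Real.log (2 + K) ≤ T := by
    have h2 : 0 ≤ 1 / B ^ 2 * K * Real.log (2 + K) := by positivity
    linarith
  have h2 := mul_log_le_of_mul_log_le hK0 (by linarith : (0 : ℝ) ≤ T) h1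
  have h3 := log_dim_le (by exact_mod_cast hdT : d ≤ T) hT
  have hKeq : 32 * a * β * d = 32 * K * (κ * ε / h) ^ 2 := by
    rw [hKdef, complexity]; field_simp
  calc T * (32 * a * β * (d * Real.log (d + T * d ^ 2)))
      = T * (32 * K * (κ * ε / h) ^ 2 * Real.log (d + T * d ^ 2)) := by rw [← hKeq]; ring
    _ ≤ T * (32 * K * (κ * ε / h) ^ 2 * (4 * Real.log (1 + T))) := by gcongr
    _ = T * (κ * ε / h) ^ 2 * (128 * K * Real.log (1 + T)) := by ring
    _ ≤ T * (κ * ε / h) ^ 2 * T := by gcongr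
    _ = _ := by ring

theorem logTerm_eq {T h m n : ℕ} {δ : ℝ} (hT : 1 ≤ T) (hh : 1 ≤ h) (hm : 1 ≤ m) (hn : 1 ≤ n)
    (hδ : 0 < δ) : logTerm T h m n δ = Real.log T + Real.log (h * m * n / δ) := by
  have : (0 : ℝ) < T := by exact_mod_cast hT
  have : (0 : ℝ) < h := by exact_mod_cast hh
  have : (0 : ℝ) < m := by exact_mod_cast hm
  have : (0 : ℝ) < n := by exact_mod_cast hn
  rw [logTerm, ← Real.log_mul (by positivity) (by positivity)]
  congr 1
  ring

end SampleComplexity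

end Opera

/-! ### The main theorem: constants, degenerate cases and conclusion -/

theorem corollary1 (B : ℝ) (hB : 0 < B) :
    ∃ c C : ℝ, 0 < c ∧ 0 < C ∧
      ∀ (S : Type u) (A : Type v) (ι : Type w) (H : ℕ) [NeZero H]
        [MeasurableSpace S] [MeasurableSpace A] [MeasurableSingletonClass A]
        [Fintype A] [Nonempty A] [Fintype ι]
        -- the true MDP
        (P : Opera.Transition S A H) [∀ h, IsMarkovKernel (P h)]
        (r : Opera.Reward S A H) (s₁ : S) (_ : Opera.IsReward P r s₁)
        -- the finite model class, containing the true model, and the policies of the models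
        (M : ι → Opera.Transition S A H) [∀ f h, IsMarkovKernel (M f h)]
        (_ : ∃ f, M f = P)
        (π : ι → Opera.Policy S A H) (_ : ∀ f, Opera.IsPolicy (π f))
        (_ : ∀ f, Opera.IsGreedy (M f) r (π f))
        -- the discriminator class
        (V : Fin H → Finset (S → A → S → ℝ)) (_ : Opera.IsDiscriminatorClass V B)
        -- finite witness rank
        (κ : ℝ) (_ : 0 < κ) (_ : κ ≤ 1)
        (_ : ∃ d, Opera.HasWitnessEmbedding P r s₁ M π V κ d)
        (ε δ : ℝ) (_ : 0 < ε) (_ : 0 < δ) (_ : δ < 1),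
        -- every sufficiently large number of iterations works
        (∀ (T : ℕ) (β : ℝ), 1 ≤ T →
          c * Opera.logTerm T H (Fintype.card ι) (Opera.discCard V) δ ≤ β →
          C * Opera.complexity H (Fintype.card A) (Opera.witnessRank P r s₁ M π V κ) β κ ε
            * Real.log (2 + Opera.complexity H (Fintype.card A)
                (Opera.witnessRank P r s₁ M π V κ) β κ ε) ≤ T →
          ∀ sel : (t : ℕ) → (Fin t → Opera.Batch S A H) → ι,
            Opera.IsOperaRule r s₁ M π V β sel →
            ENNReal.ofReal (1 - δ) ≤ Opera.operaLaw P s₁ π sel T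
              {D | Opera.IsEpsOptimal P r s₁ ε (Opera.outputValue P r s₁ π sel D)}) ∧
        -- and there is one of the claimed order
        (∀ b : ℝ, c ≤ b → ∃ T : ℕ, 1 ≤ T ∧ ∃ β K : ℝ,
          β = b * Opera.logTerm T H (Fintype.card ι) (Opera.discCard V) δ ∧
          K = Opera.complexity H (Fintype.card A)
            (Opera.witnessRank P r s₁ M π V κ) β κ ε ∧
          C * K * Real.log (2 + K) ≤ T ∧ (T : ℝ) ≤ 1 + C * K * Real.log (2 + K)) := by
  refine ⟨4 * B ^ 2, 2304 + 1 / B ^ 2, by positivity, by positivity, ?_⟩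
  intro S A ι H _ _ _ _ _ _ _ P _ r s₁ hr M _ ⟨k, hk⟩ π hπ hg V hV κ hκ hκ1 hd ε δ hε hδ hδ1
  have : Nonempty ι := ⟨k⟩
  have hH1 : 1 ≤ H := Nat.one_le_iff_ne_zero.2 (NeZero.ne H)
  have hH : (1 : ℝ) ≤ H := by exact_mod_cast hH1
  have hm1 : 1 ≤ Fintype.card ι := Fintype.card_pos
  have hm : (1 : ℝ) ≤ Fintype.card ι := by exact_mod_cast hm1
  have hn1 := Opera.one_le_discCard hV
  have hn : (1 : ℝ) ≤ Opera.discCard V := by exact_mod_cast hn1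
  refine ⟨fun T β hT hβ hK sel hsel => ?_, fun b hb => ?_⟩
  · have hprob := Opera.isProbabilityMeasure_operaLaw (P := P) (s₁ := s₁) hπ hsel.measurable T
    have hT' : (1 : ℝ) ≤ T := by exact_mod_cast hT
    by_cases htriv : ∀ D : Fin T → Opera.Batch S A H,
        Opera.IsEpsOptimal P r s₁ ε (Opera.outputValue P r s₁ π sel D)
    · rw [Set.eq_univ_of_forall (s := {D | Opera.IsEpsOptimal P r s₁ ε
        (Opera.outputValue P r s₁ π sel D)}) htriv, measure_univ, ← ENNReal.ofReal_one]
      exact ENNReal.ofReal_le_ofReal (by linarith)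
    -- All values lie in `[0, 1]`, so any output is `ε`-optimal for `ε > 1`.
    have hε1 : ε ≤ 1 := by
      by_contra! hlt
      refine htriv fun D π' hπ' => ?_
      have h1 := Opera.value_le_one s₁ hπ' hr
      have h2 : 0 ≤ Opera.outputValue P r s₁ π sel D :=
        div_nonneg (Finset.sum_nonneg fun t _ => Opera.value_nonneg s₁ (hπ _) hr) (by linarith)
      linarith
    -- With a single model every chosen policy is optimal. Excluding this case keeps the logarithm
    -- above `log 2`; otherwise, for `δ` near `1`, `β` could be too small for the elliptic
    -- potential.
    have hm2 : 2 ≤ Fintype.card ι := by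
      by_contra! hlt
      have hsub : Subsingleton ι := Fintype.card_le_one_iff_subsingleton.1 (by omega)
      refine htriv fun D => Opera.isEpsOptimal_of_sum_regret_le hr hT ?_
      have h0 : ∀ t, Opera.vOpt P r 0 s₁ - Opera.value P r s₁ (π (Opera.chosen sel D t)) = 0 := by
        intro t
        have h1 : Opera.IsGreedy P r (π (Opera.chosen sel D t)) := by
          have := hg (Opera.chosen sel D t)
          rwa [Subsingleton.elim (Opera.chosen sel D t) k, hk,
            ← Subsingleton.elim (Opera.chosen sel D t) k] at this
        rw [Opera.vOpt_sub_value_eq hr (hπ _) h1]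
        exact Finset.sum_eq_zero fun h _ => Opera.modelGap_self _ _ _ _ _ _
      rw [Finset.sum_eq_zero fun t _ => h0 t]
      positivity
    set N : ℝ := T * H * Fintype.card ι * Opera.discCard V with hN
    have hN2 : 2 ≤ N := by
      have h1 : (2 : ℝ) ≤ Fintype.card ι := by exact_mod_cast hm2
      have h2 : (1 : ℝ) ≤ T * H := one_le_mul_of_one_le_of_one_le hT' hH
      calc (2 : ℝ) = 1 * 2 * 1 := by norm_num
        _ ≤ N := by rw [hN]; gcongr
    have hlog : Real.log (N / δ) ≤ β / (4 * B ^ 2) := by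
      rw [le_div_iff₀' (by positivity)]
      exact hβ
    have hβB : 2 * B ^ 2 ≤ β := by
      have h1 : Real.log 2 ≤ Real.log (N / δ) :=
        Real.log_le_log (by norm_num) (hN2.trans (by
          rw [le_div_iff₀ hδ]; nlinarith))
      have h2 : 1 / 2 ≤ β / (4 * B ^ 2) := by linarith [Real.log_two_gt_d9]
      rw [le_div_iff₀ (by positivity)] at h2
      linarith
    have hbad : Opera.operaLaw P s₁ π sel T
        (Opera.goodEvent P s₁ B M π V sel (β / (4 * B ^ 2)) T)ᶜ ≤ ENNReal.ofReal δ := by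
      refine (Opera.operaLaw_compl_goodEvent_le hπ hsel.measurable hB hV _ T).trans
        (ENNReal.ofReal_le_ofReal ?_)
      rw [← hN]
      have h1 : Real.exp (-(β / (4 * B ^ 2))) ≤ δ / N := by
        have h2 := Real.exp_le_exp.2 (neg_le_neg hlog)
        rwa [Real.exp_neg (Real.log (N / δ)), Real.exp_log (by positivity), inv_div] at h2
      calc N * Real.exp (-(β / (4 * B ^ 2))) ≤ N * (δ / N) := by gcongr
        _ = δ := by field_simp
    have hgood : Opera.goodEvent P s₁ B M π V sel (β / (4 * B ^ 2)) T
        ⊆ {D | Opera.IsEpsOptimal P r s₁ ε (Opera.outputValue P r s₁ π sel D)} := by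
      intro D hD
      refine Opera.isEpsOptimal_of_sum_regret_le hr hT ?_
      -- As some embedding exists, the witness rank is itself attained. The choice of `x` makes the
      -- regret bound `H * x / κ` equal to `T * ε`.
      have h1 := Opera.sum_regret_le hr hk hπ hg hB hV hκ (Nat.sInf_mem hd) (β := β)
        (by nlinarith [sq_nonneg B]) hsel hD (x := T * (κ * ε / H)) (by positivity)
        (Opera.iterations_bound hB hH1 Fintype.card_pos hT hβB hκ hκ1 hε hε1 hK)
      refine h1.trans_eq ?_
      field_simp
    refine le_trans ?_ (measure_mono hgood)
    have h1 : (1 : ENNReal) ≤ Opera.operaLaw P s₁ π sel T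
        (Opera.goodEvent P s₁ B M π V sel (β / (4 * B ^ 2)) T) + ENNReal.ofReal δ := by
      rw [← measure_univ (μ := Opera.operaLaw P s₁ π sel T), ← Set.union_compl_self
        (Opera.goodEvent P s₁ B M π V sel (β / (4 * B ^ 2)) T)]
      exact (measure_union_le _ _).trans (by gcongr)
    rw [ENNReal.ofReal_sub _ hδ.le, ENNReal.ofReal_one]
    exact tsub_le_iff_right.2 h1
  · have hb0 : 0 ≤ b := le_trans (by positivity) hb
    have hL : 0 ≤ Real.log (H * Fintype.card ι * Opera.discCard V / δ) := by
      refine Real.log_nonneg ?_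
      rw [one_le_div hδ]
      have : (1 : ℝ) ≤ H * Fintype.card ι * Opera.discCard V :=
        one_le_mul_of_one_le_of_one_le (one_le_mul_of_one_le_of_one_le hH hm) hn
      linarith
    -- The complexity is linear in `β`, so `K` is an affine function of `log T` whose slope is the
    -- complexity at `b`.
    obtain ⟨T, hT, h1, h2⟩ := Opera.exists_nat_mul_log_le (C := 2304 + 1 / B ^ 2)
      (a := Opera.complexity H (Fintype.card A) (Opera.witnessRank P r s₁ M π V κ) b κ ε)
      (L := Real.log (H * Fintype.card ι * Opera.discCard V / δ)) (by positivity)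
      (by rw [Opera.complexity]; positivity) hL
    refine ⟨T, hT, _, _, rfl, rfl, ?_⟩
    have h3 : Opera.complexity H (Fintype.card A) (Opera.witnessRank P r s₁ M π V κ)
        (b * Opera.logTerm T H (Fintype.card ι) (Opera.discCard V) δ) κ ε
        = Opera.complexity H (Fintype.card A) (Opera.witnessRank P r s₁ M π V κ) b κ ε
          * (Real.log T + Real.log (H * Fintype.card ι * Opera.discCard V / δ)) := by
      rw [Opera.logTerm_eq hT hH1 hm1 hn1 hδ, Opera.complexity, Opera.complexity]
      ring
    rw [h3]
    exact ⟨h1, h2⟩
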